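/- Let $R$ be a commutative ring (for example $\mathbb{Z}[\tfrac12,\sqrt{-1}]$) and let $N\in\mathbb{Z}_{\geq 0}$. Consider strict pivotal monoidal $R$-linear categories $\otimes$-generated by objects $k\in\mathbb{Z}_{\geq 0}$ with $0=\mathbb{1}$ and $k^{\ast}=k$, and $\circ$-$\otimes$-generated by merges $k\otimes l\to k{+}l$, splits $k{+}l\to k\otimes l$, crossings $k\otimes l\to l\otimes k$, caps $k\otimes k\to\mathbb{1}$ and cups $\mathbb{1}\to k\otimes k$ (edges labelled $0$ are erased, diagrams are read from bottom to top and up to planar isotopy: zigzag relations for caps and cups, and invariance of trivalent vertices and crossings under rotation). The orthogonal web relations are: 1. the type A relations: the identity of $k$ is $0$ for $k>N$; associativity of merges and coassociativity of splits; digon removal (split $k{+}l\to k\otimes l$ followed by the merge is $\binom{k+l}{k}$ times the identity); and the signed Schur relation, for $k+l=r+s$: the merge $k\otimes l\to k{+}l$ followed by the split to $r\otimes s$ equals $\sum_{0\le a\le k,\,0\le b\le l,\;k-a+b=r}(-1)^{ab}D_{a,b}$, where $D_{a,b}$ splits $k$ into $(k{-}a)\otimes a$ and $l$ into $b\otimes(l{-}b)$,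 crosses $a$ with $b$, and merges $(k{-}a)\otimes b$ to $r$ and $a\otimes(l{-}b)$ to $s$; 2. circle removal (the circle labelled $k$ is $\binom{N}{k}$) and the lollipop relations: for $l\ge 0$ and $a>0$, splitting $l{+}2a\to l\otimes a\otimes a$ and capping off the two strands $a$ is zero, and likewise for $l{+}2a\to a\otimes a\otimes l$; 3. the higher even orthogonal $E$-$F$ relations: for $k,l,a,b\in\mathbb{Z}_{\geq 0}$ with $b\le k+a$ and $b\le l+a$, $$f^{(b)}e^{(a)}\mathbf{1}_{k\otimes l}=\sum_{x=0}^{\min\{a,b\}}\binom{N-k-l+b-a}{x}\,e^{(a-x)}f^{(b-x)}\mathbf{1}_{k\otimes l},$$ where $e^{(c)}\colon u\otimes v\to(u{+}c)\otimes(v{+}c)$ inserts a cup labelled $c$ between the two strands and merges its ends into them, $f^{(c)}\colon u\otimes v\to(u{-}c)\otimes(v{-}c)$ splits a strand labelled $c$ off each strand, on the inner side, and joins them by a cap, and diagrams with a negative label are zero. Consider the category presented by the relations in 1 and 2 together with only those relations in 3 for which $k,l\le\min\{a,b\}$. Then in this category the relations in 3 hold for all $k,l,a,b\in\mathbb{Z}_{\geq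 0}$ with $b\le k+a$ and $b\le l+a$. -/

import Mathlib

open CategoryTheory

universe u

/-! # Orthogonal exterior webs by generators and relations

The category is built as the strict monoidal `R`-linear category presented by generators and
relations: formal expressions in the generating diagrams, modulo the congruence generated by the
laws of strict monoidal linear categories and by the defining relations. -/

namespace OrthWeb

/-- Objects: words in positive labels. The tensor product is concatenation `++`, the unit `𝟙` is
the empty word `[]`. -/
abbrev Obj : Type := List ℕ+

/-- The object `k` for `k : ℕ`; the object `0` is the monoidal unit. -/
def strand : ℕ → Obj
  | 0 => []
  | k + 1 => [k.succPNat]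

/-- The object `(k₁, …, kᵣ) = k₁ ⊗ ⋯ ⊗ kᵣ` for labels `kᵢ : ℕ` (zeros disappear). -/
def word : List ℕ → Obj
  | [] => []
  | k :: K => strand k ++ word K

@[simp] theorem word_nil : word [] = [] := rfl

@[simp] theorem word_cons (k : ℕ) (K : List ℕ) : word (k :: K) = strand k ++ word K := rfl

@[simp] theorem strand_zero : strand 0 = [] := rfl

/-- Formal `R`-linear expressions in the generating webs, from the bottom object to the top
object. Equations between objects are carried as proofs, so that the strictness of the monoidal
structure needs no transport; thus `one h` is the identity of an object written in two ways.
`comp f g` is `g ∘ f`, that is, `g` is stacked on top of `f`. -/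
inductive WebExpr (R : Type u) : Obj → Obj → Type u
  | one {X Y : Obj} (h : X = Y) : WebExpr R X Y
  | comp {X Y Z : Obj} (f : WebExpr R X Y) (g : WebExpr R Y Z) : WebExpr R X Z
  | tensor {X Y X' Y' Z W : Obj} (f : WebExpr R X Y) (g : WebExpr R X' Y')
      (hZ : Z = X ++ X') (hW : W = Y ++ Y') : WebExpr R Z W
  | zero {X Y : Obj} : WebExpr R X Y
  | add {X Y : Obj} (f g : WebExpr R X Y) : WebExpr R X Y
  | smul {X Y : Obj} (r : R) (f : WebExpr R X Y) : WebExpr R X Y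
  /-- the merge `k ⊗ l → m`, where `m = k + l` -/
  | merge (k l m : ℕ) (h : k + l = m) : WebExpr R (word [k, l]) (word [m])
  /-- the split `m → k ⊗ l`, where `m = k + l` -/
  | split (k l m : ℕ) (h : k + l = m) : WebExpr R (word [m]) (word [k, l])
  /-- the crossing `k ⊗ l → l ⊗ k` -/
  | cross (k l : ℕ) : WebExpr R (word [k, l]) (word [l, k])
  /-- the cap `k ⊗ k → 𝟙` -/
  | cap (k : ℕ) : WebExpr R (word [k, k]) (word [])
  /-- the cup `𝟙 → k ⊗ k` -/
  | cup (k : ℕ) : WebExpr R (word []) (word [k, k])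

namespace WebExpr

variable {R : Type u}

/-- Formal finite sums. -/
def sum {ι : Type} {X Y : Obj} (s : List ι) (t : ι → WebExpr R X Y) : WebExpr R X Y :=
  s.foldr (fun i e => add (t i) e) zero

/-- The whiskering `1_K ⊗ f ⊗ 1_L`. -/
def whisker {X Y Z W : Obj} (K : List ℕ) (f : WebExpr R X Y) (L : List ℕ)
    (hZ : Z = word K ++ (X ++ word L) := by simp)
    (hW : W = word K ++ (Y ++ word L) := by simp) : WebExpr R Z W :=
  tensor (one (rfl : word K = word K)) (tensor f (one (rfl : word L = word L)) rfl rfl) hZ hW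

/-- The ladder `e^{(a)} : k ⊗ l → k' ⊗ l'`, `k' = k + a`, `l' = l + a`: a cup labelled `a`
between the two strands, whose ends are merged into them. -/
def cupLadder (k l a k' l' : ℕ) (hk : k + a = k') (hl : a + l = l') :
    WebExpr R (word [k, l]) (word [k', l']) :=
  comp (Y := word [k, a, a, l])
    (whisker [k] (cup a) [l])
    (tensor (merge k a k' hk) (merge a l l' hl) (by simp) (by simp))

/-- The ladder `f^{(a)} : k ⊗ l → k' ⊗ l'`, `k' = k - a`, `l' = l - a`: an `a`-labelled strand is
split off from both strands, and the two are joined by a cap. -/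
def capLadder (k l a k' l' : ℕ) (hk : k' + a = k) (hl : a + l' = l) :
    WebExpr R (word [k, l]) (word [k', l']) :=
  comp (Y := word [k', a, a, l'])
    (tensor (split k' a k hk) (split a l' l hl) (by simp) (by simp))
    (whisker [k'] (cap a) [l'])

/-- The diagram on the right-hand side of the Schur relation: `a` crosses from the left strand to
the right one, and `b` from the right strand to the left one. -/
def crossLadder (k l r s a b : ℕ) (ha : a ≤ k) (hb : b ≤ l) (hr : k - a + b = r)
    (hs : a + (l - b) = s) : WebExpr R (word [k, l]) (word [r, s]) :=
  comp (Y := word [k - a, a, b, l - b])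
    (tensor (split (k - a) a k (Nat.sub_add_cancel ha))
      (split b (l - b) l (Nat.add_sub_cancel' hb)) (by simp) (by simp))
    (comp (Y := word [k - a, b, a, l - b])
      (whisker [k - a] (cross a b) [l - b])
      (tensor (merge (k - a) b r hr) (merge a (l - b) s hs) (by simp) (by simp)))

/-- The diagram on the left-hand side of the higher even orthogonal `E`-`F` relation, from `k ⊗ l`
to `p ⊗ q` with `p = k + a - b`, `q = l + a - b`: first the cup ladder labelled `a`, then, above
it, the cap ladder labelled `b`. -/
def efLeft (k l a b p q : ℕ) (hp : p + b = k + a) (hq : q + b = l + a) :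
    WebExpr R (word [k, l]) (word [p, q]) :=
  comp (cupLadder k l a (k + a) (l + a) rfl (Nat.add_comm a l))
    (capLadder (k + a) (l + a) b p q hp ((Nat.add_comm b q).trans hq))

/-- The `x`-th diagram on the right-hand side of the higher even orthogonal `E`-`F` relation: first
the cap ladder labelled `b - x`, then, above it, the cup ladder labelled `a - x`. It is zero if
one of the labels is negative. -/
def efRight (k l a b p q : ℕ) (hp : p + b = k + a) (hq : q + b = l + a) (x : ℕ) :
    WebExpr R (word [k, l]) (word [p, q]) :=
  if h : x ≤ a ∧ x ≤ b ∧ b ≤ k + x ∧ b ≤ l + x then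
    comp
      (capLadder k l (b - x) (k - (b - x)) (l - (b - x)) (by omega) (by omega))
      (cupLadder (k - (b - x)) (l - (b - x)) (a - x) p q (by omega) (by omega))
  else zero

end WebExpr

/-- The coefficient `binom(N - k - l + b - a, x)`, a binomial coefficient with integral, possibly
negative, upper entry. -/
def efCoeff (N k l a b x : ℕ) : ℤ :=
  Ring.choose ((N : ℤ) - k - l + b - a) x

open WebExpr in
/-- The defining relations of orthogonal webs for `O(N)`, where the higher even orthogonal `E`-`F`
relation with parameters `k, l, a, b` is imposed only if `P k l a b` holds. -/
inductive DefRel (R : Type u) [CommRing R] (N : ℕ) (P : ℕ → ℕ → ℕ → ℕ → Prop) :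
    ∀ {X Y : Obj}, WebExpr R X Y → WebExpr R X Y → Prop
  -- Edges labelled `0` are not drawn.
  | zero_merge (k : ℕ) :
      DefRel R N P (merge 0 k k (Nat.zero_add k)) (one (by simp))
  | merge_zero (k : ℕ) :
      DefRel R N P (merge k 0 k rfl) (one (by simp))
  | zero_split (k : ℕ) :
      DefRel R N P (split 0 k k (Nat.zero_add k)) (one (by simp))
  | split_zero (k : ℕ) :
      DefRel R N P (split k 0 k rfl) (one (by simp))
  | zero_cross (k : ℕ) : DefRel R N P (cross 0 k) (one (by simp))
  | cross_zero (k : ℕ) : DefRel R N P (cross k 0) (one (by simp))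
  | cap_zero : DefRel R N P (cap 0) (one (by simp))
  | cup_zero : DefRel R N P (cup 0) (one (by simp))
  -- Pivotal structure with `k* = k`: zigzag relations, and invariance of the generating
  -- diagrams (trivalent vertices, crossings) under rotation in the plane.
  | zigzag_left (k : ℕ) : DefRel R N P
      (comp (Y := word [k, k, k]) (whisker [] (cup k) [k]) (whisker [k] (cap k) []))
      (one (rfl : word [k] = word [k]))
  | zigzag_right (k : ℕ) : DefRel R N P
      (comp (Y := word [k, k, k]) (whisker [k] (cup k) []) (whisker [] (cap k) [k]))
      (one (rfl : word [k] = word [k]))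
  | rotate_vertex_left (k l m : ℕ) (h : k + l = m) : DefRel R N P
      (comp (X := word [k, l, m]) (Y := word [m, m])
        (whisker [] (merge k l m h) [m]) (cap m))
      (comp (Y := word [k, l, l, k])
        (whisker [k, l] (split l k m ((Nat.add_comm l k).trans h)) [])
        (comp (Y := word [k, k]) (whisker [k] (cap l) [k]) (cap k)))
  | rotate_vertex_right (k l m : ℕ) (h : k + l = m) : DefRel R N P
      (comp (X := word [m, k, l]) (Y := word [m, m])
        (whisker [m] (merge k l m h) []) (cap m))
      (comp (Y := word [l, k, k, l])
        (whisker [] (split l k m ((Nat.add_comm l k).trans h)) [k, l])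
        (comp (Y := word [l, l]) (whisker [l] (cap k) [l]) (cap l)))
  | rotate_cross_left (k l : ℕ) : DefRel R N P
      (comp (X := word [l, k]) (Y := word [k, k, l, k]) (whisker [] (cup k) [l, k])
        (comp (Y := word [k, l, k, k]) (whisker [k] (cross k l) [k])
          (whisker [k, l] (cap k) [])))
      (cross l k)
  | rotate_cross_right (k l : ℕ) : DefRel R N P
      (comp (X := word [l, k]) (Y := word [l, k, l, l]) (whisker [l, k] (cup l) [])
        (comp (Y := word [l, l, k, l]) (whisker [l] (cross k l) [l])
          (whisker [] (cap l) [k, l])))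
      (cross l k)
  -- Type A web relations.
  | exterior (k : ℕ) (hk : N < k) : DefRel R N P (one (rfl : word [k] = word [k])) zero
  | assoc (k l m : ℕ) : DefRel R N P
      (comp (X := word [k, l, m]) (Y := word [k + l, m])
        (whisker [] (merge k l (k + l) rfl) [m]) (merge (k + l) m (k + l + m) rfl))
      (comp (Y := word [k, l + m])
        (whisker [k] (merge l m (l + m) rfl) [])
        (merge k (l + m) (k + l + m) (Nat.add_assoc k l m).symm))
  | coassoc (k l m : ℕ) : DefRel R N P
      (comp (Z := word [k, l, m]) (Y := word [k + l, m])
        (split (k + l) m (k + l + m) rfl) (whisker [] (split k l (k + l) rfl) [m]))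
      (comp (Y := word [k, l + m])
        (split k (l + m) (k + l + m) (Nat.add_assoc k l m).symm)
        (whisker [k] (split l m (l + m) rfl) []))
  | digon (k l : ℕ) : DefRel R N P
      (comp (split k l (k + l) rfl) (merge k l (k + l) rfl))
      (smul ((k + l).choose k : R) (one rfl))
  | schur (k l r s m : ℕ) (hkl : k + l = m) (hrs : r + s = m) : DefRel R N P
      (comp (merge k l m hkl) (split r s m hrs))
      (sum (List.range (k + 1)) fun a => sum (List.range (l + 1)) fun b =>
        if h : a ≤ k ∧ b ≤ l ∧ k - a + b = r then
          smul ((-1) ^ (a * b))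
            (crossLadder k l r s a b h.1 h.2.1 h.2.2 (by omega))
        else zero)
  -- Circle removal and lollipop relations.
  | circle (k : ℕ) : DefRel R N P
      (comp (cup k) (cap k)) (smul (N.choose k : R) (one rfl))
  | lollipop_right (l a : ℕ) (ha : 0 < a) : DefRel R N P
      (comp (X := word [l + a + a]) (Z := word [l]) (Y := word [l + a, a])
        (split (l + a) a (l + a + a) rfl)
        (comp (Y := word [l, a, a])
          (whisker [] (split l a (l + a) rfl) [a]) (whisker [l] (cap a) [])))
      zero
  | lollipop_left (l a : ℕ) (ha : 0 < a) : DefRel R N P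
      (comp (X := word [a + (a + l)]) (Z := word [l]) (Y := word [a, a + l])
        (split a (a + l) (a + (a + l)) rfl)
        (comp (Y := word [a, a, l])
          (whisker [a] (split a l (a + l) rfl) []) (whisker [] (cap a) [l])))
      zero
  -- Higher even orthogonal `E`-`F` relations.
  | ef (k l a b p q : ℕ) (hp : p + b = k + a) (hq : q + b = l + a) (hP : P k l a b) :
      DefRel R N P
        (efLeft k l a b p q hp hq)
        (sum (List.range (min a b + 1)) fun x =>
          smul (efCoeff N k l a b x : R) (efRight k l a b p q hp hq x))

open WebExpr in
/-- The congruence on formal expressions generated by a family `B` of relations together with the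
laws of a strict monoidal `R`-linear category: the smallest equivalence relation that contains
these and is compatible with composition, tensor products and linear combinations. -/
inductive Cong {R : Type u} [CommRing R]
    (B : ∀ {X Y : Obj}, WebExpr R X Y → WebExpr R X Y → Prop) :
    ∀ {X Y : Obj}, WebExpr R X Y → WebExpr R X Y → Prop
  | of {X Y : Obj} {f g : WebExpr R X Y} : B f g → Cong B f g
  -- equivalence relation
  | refl {X Y : Obj} (f : WebExpr R X Y) : Cong B f f
  | symm {X Y : Obj} {f g : WebExpr R X Y} : Cong B f g → Cong B g f
  | trans {X Y : Obj} {f g h : WebExpr R X Y} : Cong B f g → Cong B g h → Cong B f h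
  -- compatibility with the operations
  | comp_congr {X Y Z : Obj} {f f' : WebExpr R X Y} {g g' : WebExpr R Y Z} :
      Cong B f f' → Cong B g g' → Cong B (comp f g) (comp f' g')
  | tensor_congr {X Y X' Y' Z W : Obj} {f f' : WebExpr R X Y} {g g' : WebExpr R X' Y'}
      (hZ : Z = X ++ X') (hW : W = Y ++ Y') :
      Cong B f f' → Cong B g g' → Cong B (tensor f g hZ hW) (tensor f' g' hZ hW)
  | add_congr {X Y : Obj} {f f' g g' : WebExpr R X Y} :
      Cong B f f' → Cong B g g' → Cong B (add f g) (add f' g')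
  | smul_congr {X Y : Obj} (r : R) {f f' : WebExpr R X Y} :
      Cong B f f' → Cong B (smul r f) (smul r f')
  -- morphisms form `R`-modules
  | add_assoc {X Y : Obj} (f g h : WebExpr R X Y) :
      Cong B (add (add f g) h) (add f (add g h))
  | add_comm {X Y : Obj} (f g : WebExpr R X Y) : Cong B (add f g) (add g f)
  | zero_add {X Y : Obj} (f : WebExpr R X Y) : Cong B (add zero f) f
  | neg_add {X Y : Obj} (f : WebExpr R X Y) : Cong B (add (smul (-1) f) f) zero
  | one_smul {X Y : Obj} (f : WebExpr R X Y) : Cong B (smul 1 f) f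
  | mul_smul {X Y : Obj} (r s : R) (f : WebExpr R X Y) :
      Cong B (smul (r * s) f) (smul r (smul s f))
  | smul_add {X Y : Obj} (r : R) (f g : WebExpr R X Y) :
      Cong B (smul r (add f g)) (add (smul r f) (smul r g))
  | add_smul {X Y : Obj} (r s : R) (f : WebExpr R X Y) :
      Cong B (smul (r + s) f) (add (smul r f) (smul s f))
  -- category
  | id_comp {X Y : Obj} (f : WebExpr R X Y) : Cong B (comp (one rfl) f) f
  | comp_id {X Y : Obj} (f : WebExpr R X Y) : Cong B (comp f (one rfl)) f
  | comp_assoc {X Y Z W : Obj} (f : WebExpr R X Y) (g : WebExpr R Y Z) (h : WebExpr R Z W) :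
      Cong B (comp (comp f g) h) (comp f (comp g h))
  -- bilinearity of composition
  | add_comp {X Y Z : Obj} (f f' : WebExpr R X Y) (g : WebExpr R Y Z) :
      Cong B (comp (add f f') g) (add (comp f g) (comp f' g))
  | comp_add {X Y Z : Obj} (f : WebExpr R X Y) (g g' : WebExpr R Y Z) :
      Cong B (comp f (add g g')) (add (comp f g) (comp f g'))
  | smul_comp {X Y Z : Obj} (r : R) (f : WebExpr R X Y) (g : WebExpr R Y Z) :
      Cong B (comp (smul r f) g) (smul r (comp f g))
  | comp_smul {X Y Z : Obj} (r : R) (f : WebExpr R X Y) (g : WebExpr R Y Z) :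
      Cong B (comp f (smul r g)) (smul r (comp f g))
  -- bilinearity of the tensor product
  | add_tensor {X Y X' Y' Z W : Obj} (f f' : WebExpr R X Y) (g : WebExpr R X' Y')
      (hZ : Z = X ++ X') (hW : W = Y ++ Y') :
      Cong B (tensor (add f f') g hZ hW) (add (tensor f g hZ hW) (tensor f' g hZ hW))
  | tensor_add {X Y X' Y' Z W : Obj} (f : WebExpr R X Y) (g g' : WebExpr R X' Y')
      (hZ : Z = X ++ X') (hW : W = Y ++ Y') :
      Cong B (tensor f (add g g') hZ hW) (add (tensor f g hZ hW) (tensor f g' hZ hW))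
  | smul_tensor {X Y X' Y' Z W : Obj} (r : R) (f : WebExpr R X Y) (g : WebExpr R X' Y')
      (hZ : Z = X ++ X') (hW : W = Y ++ Y') :
      Cong B (tensor (smul r f) g hZ hW) (smul r (tensor f g hZ hW))
  | tensor_smul {X Y X' Y' Z W : Obj} (r : R) (f : WebExpr R X Y) (g : WebExpr R X' Y')
      (hZ : Z = X ++ X') (hW : W = Y ++ Y') :
      Cong B (tensor f (smul r g) hZ hW) (smul r (tensor f g hZ hW))
  -- strict monoidal structure
  | tensor_id {X X' Z W : Obj} (hZ : Z = X ++ X') (hW : W = X ++ X') :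
      Cong B (tensor (one (rfl : X = X)) (one (rfl : X' = X')) hZ hW) (one (hZ.trans hW.symm))
  | tensor_comp {X Y Z X' Y' Z' V W : Obj} (f : WebExpr R X Y) (g : WebExpr R Y Z)
      (f' : WebExpr R X' Y') (g' : WebExpr R Y' Z') (hV : V = X ++ X') (hW : W = Z ++ Z') :
      Cong B (tensor (comp f g) (comp f' g') hV hW)
        (comp (tensor f f' hV rfl) (tensor g g' rfl hW))
  | tensor_assoc {X Y X' Y' X'' Y'' Z W : Obj} (f : WebExpr R X Y) (g : WebExpr R X' Y')
      (h : WebExpr R X'' Y'') (hZ : Z = X ++ (X' ++ X'')) (hW : W = Y ++ (Y' ++ Y'')) :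
      Cong B
        (tensor (tensor f g rfl rfl) h (hZ.trans (List.append_assoc X X' X'').symm)
          (hW.trans (List.append_assoc Y Y' Y'').symm))
        (tensor f (tensor g h rfl rfl) hZ hW)
  | unit_tensor {X Y : Obj} (f : WebExpr R X Y) :
      Cong B (tensor (one (rfl : ([] : Obj) = [])) f (List.nil_append X).symm
        (List.nil_append Y).symm) f
  | tensor_unit {X Y : Obj} (f : WebExpr R X Y) :
      Cong B (tensor f (one (rfl : ([] : Obj) = [])) (List.append_nil X).symm
        (List.append_nil Y).symm) f

/-- Equality of expressions in the presented web category. -/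
def webSetoid (R : Type u) [CommRing R] (N : ℕ) (P : ℕ → ℕ → ℕ → ℕ → Prop) (X Y : Obj) :
    Setoid (WebExpr R X Y) where
  r := Cong (DefRel R N P)
  iseqv := ⟨Cong.refl, Cong.symm, Cong.trans⟩

/-- The category of orthogonal webs over `R` in which, of the higher even orthogonal `E`-`F`
relations, those with `P k l a b` are imposed. Taking `P` to be always true gives the category of
orthogonal webs. -/
structure Web (R : Type u) [CommRing R] (N : ℕ) (P : ℕ → ℕ → ℕ → ℕ → Prop) where
  /-- the underlying word of labels -/
  obj : Obj

namespace Web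

variable {R : Type u} [CommRing R] {N : ℕ} {P : ℕ → ℕ → ℕ → ℕ → Prop}

/-- Morphisms of the web category. -/
def Hom (X Y : Web R N P) : Type u := Quotient (webSetoid R N P X.obj Y.obj)

instance : Category (Web R N P) where
  Hom := Hom
  id _ := Quotient.mk _ (WebExpr.one rfl)
  comp := Quotient.map₂ WebExpr.comp fun _ _ h _ _ h' => Cong.comp_congr h h'
  id_comp := by rintro _ _ ⟨f⟩; exact Quotient.sound (Cong.id_comp f)
  comp_id := by rintro _ _ ⟨f⟩; exact Quotient.sound (Cong.comp_id f)
  assoc := by rintro _ _ _ _ ⟨f⟩ ⟨g⟩ ⟨h⟩; exact Quotient.sound (Cong.comp_assoc f g h)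

/-- The morphism represented by an expression. -/
def ofExpr {X Y : Obj} (f : WebExpr R X Y) : (⟨X⟩ : Web R N P) ⟶ ⟨Y⟩ :=
  Quotient.mk (webSetoid R N P X Y) f

instance (X Y : Web R N P) : AddCommGroup (X ⟶ Y) where
  add := Quotient.map₂ WebExpr.add fun _ _ h _ _ h' => Cong.add_congr h h'
  zero := Quotient.mk _ WebExpr.zero
  neg := Quotient.map (WebExpr.smul (-1)) fun _ _ h => Cong.smul_congr (-1) h
  add_assoc := by rintro ⟨f⟩ ⟨g⟩ ⟨h⟩; exact Quotient.sound (Cong.add_assoc f g h)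
  zero_add := by rintro ⟨f⟩; exact Quotient.sound (Cong.zero_add f)
  add_zero := by
    rintro ⟨f⟩; exact Quotient.sound ((Cong.add_comm _ _).trans (Cong.zero_add f))
  neg_add_cancel := by rintro ⟨f⟩; exact Quotient.sound (Cong.neg_add f)
  add_comm := by rintro ⟨f⟩ ⟨g⟩; exact Quotient.sound (Cong.add_comm f g)
  nsmul := @nsmulRec _ ⟨Quotient.mk _ WebExpr.zero⟩
    ⟨Quotient.map₂ WebExpr.add fun _ _ h _ _ h' => Cong.add_congr h h'⟩
  zsmul := @zsmulRec _ ⟨Quotient.mk _ WebExpr.zero⟩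
    ⟨Quotient.map₂ WebExpr.add fun _ _ h _ _ h' => Cong.add_congr h h'⟩
    ⟨Quotient.map (WebExpr.smul (-1)) fun _ _ h => Cong.smul_congr (-1) h⟩
    (@nsmulRec _ ⟨Quotient.mk _ WebExpr.zero⟩
      ⟨Quotient.map₂ WebExpr.add fun _ _ h _ _ h' => Cong.add_congr h h'⟩)

instance (X Y : Web R N P) : SMul R (X ⟶ Y) where
  smul r := Quotient.map (WebExpr.smul r) fun _ _ h => Cong.smul_congr r h

instance (X Y : Web R N P) : Module R (X ⟶ Y) :=
  Module.ofMinimalAxioms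
    (by rintro r ⟨f⟩ ⟨g⟩; exact Quotient.sound (Cong.smul_add r f g))
    (by rintro r s ⟨f⟩; exact Quotient.sound (Cong.add_smul r s f))
    (by rintro r s ⟨f⟩; exact Quotient.sound (Cong.mul_smul r s f))
    (by rintro ⟨f⟩; exact Quotient.sound (Cong.one_smul f))

instance : Preadditive (Web R N P) where
  add_comp := by rintro _ _ _ ⟨f⟩ ⟨f'⟩ ⟨g⟩; exact Quotient.sound (Cong.add_comp f f' g)
  comp_add := by rintro _ _ _ ⟨f⟩ ⟨g⟩ ⟨g'⟩; exact Quotient.sound (Cong.comp_add f g g')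

instance : Linear R (Web R N P) where
  smul_comp := by rintro _ _ _ r ⟨f⟩ ⟨g⟩; exact Quotient.sound (Cong.smul_comp r f g)
  comp_smul := by rintro _ _ _ ⟨f⟩ r ⟨g⟩; exact Quotient.sound (Cong.comp_smul r f g)

end Web

/-- The parameters with `k, l ≤ min {a, b}`. -/
def Small (k l a b : ℕ) : Prop := k ≤ min a b ∧ l ≤ min a b

end OrthWeb

namespace OrthWeb

section families

/-! ### Families determined by their small members -/

/-! Put `m = min {a, b}` and write `k = d + κ`, `l = d + μ`, `a = d' + m`, `b = d + m`, `p = d' +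
κ`, `q = d' + μ`, where `d = 0` or `d' = 0`. With all parameters but `κ` fixed, the two sides of the
relation become families `S κ` and `U κ`, indexed by the thickness of the left strand. Let `Φ i κ`
(`bypassFrom`) split a strand of thickness `κ - i` off to the far left, apply a diagram of level `i`
next to it, and merge the strand back. Associativity and digon removal give `Φ z κ ∘ Φ i z = binom(κ
- i, κ - z) Φ i κ` (`bypassFrom_bypassFrom`). The Schur relation on the left strand gives `S κ =
∑_{i ≤ m} Φ i κ (M i)` with `M i` independent of `κ` (`mg_sp_eq_sum_bypassFrom`). A cap ladder
followed by a cup ladder is itself a bypass, so `U κ = ∑_{i ≤ m} binom(n - κ, m - i) Φ i κ (T i)`.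
For `κ > m` the sum `∑_{z ≤ κ} (-1)^(κ - z) Φ z κ (F z)` vanishes for `F = S` and for `F = U`,
because its coefficients are differences of order `κ - i` of polynomials of degree at most `m - i`.
Hence the members with `κ ≤ m` determine the others (`family_eq_of_le`), and the relation for `κ ≤
m` implies it for every `κ` (`EFRel.of_thin_left`). A half turn of the plane exchanges `κ` with `μ`
and `d` with `d'` (`EFRel.rotate`), which gives the same reduction for the right strand and turns
the case `d' = 0` into `d = 0`. There, `κ, μ ≤ m` is exactly the condition `Small`. -/

/-- By Pascal's rule each difference lowers `e` by one, as for a polynomial of degree `e`. -/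
theorem fwdDiff_iter_ringChoose (D e : ℕ) (h : e < D) :
    (fwdDiff (1 : ℤ))^[D] (fun r : ℤ => Ring.choose r e) = 0 := by
  induction D generalizing e with
  | zero => omega
  | succ D ih =>
    rw [Function.iterate_succ_apply]
    cases e with
    | zero =>
      have : fwdDiff (1 : ℤ) (fun r : ℤ => Ring.choose r 0) = 0 := by
        funext r; simp [fwdDiff]
      rw [this]
      clear ih this h
      induction D with
      | zero => rfl
      | succ D ih =>
        rw [Function.iterate_succ_apply]
        convert ih using 2
        funext r; simp [fwdDiff]
    | succ e =>
      have : fwdDiff (1 : ℤ) (fun r : ℤ => Ring.choose r (e + 1)) = fun r => Ring.choose r e := by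
        funext r; simp [fwdDiff, Ring.choose_succ_succ]
      rw [this, ih e (by omega)]

/-- With `w = κ - z` this is, up to sign, the difference of order `κ - i` of `r ↦ Ring.choose r e`
at `n - κ`, and `e < κ - i`. -/
theorem sum_alternating_choose (κ i e : ℕ) (n : ℤ) (h : e + i < κ) :
    ∑ z ∈ Finset.range (κ + 1),
      ((-1) ^ (κ - z) * ((κ - i).choose (κ - z) : ℤ) * Ring.choose (n - z) e) = 0 := by
  rw [← Finset.sum_flip]
  have h1 := congrFun (fwdDiff_iter_ringChoose (κ - i) e (by omega)) (n - κ)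
  rw [fwdDiff_iter_eq_sum_shift] at h1
  have h2 : ∑ w ∈ Finset.range (κ - i + 1),
      ((-1 : ℤ) ^ (κ - i - w) * ((κ - i).choose w : ℤ) * Ring.choose (n - κ + w) e) = 0 := by
    simpa using h1
  have h3 := congrArg ((-1 : ℤ) ^ (κ - i) * ·) h2
  simp only [mul_zero, Finset.mul_sum] at h3
  rw [← h3]
  symm
  -- The extra terms, those with `w > κ - i`, vanish with their binomial coefficient.
  refine Finset.sum_subset_zero_on_sdiff (by intro x; simp; omega) ?_ ?_
  · intro w hw
    simp only [Finset.mem_sdiff, Finset.mem_range] at hw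
    rw [show κ - (κ - w) = w by omega, Nat.choose_eq_zero_of_lt (by omega)]
    simp
  · intro w hw
    simp only [Finset.mem_range] at hw
    rw [show κ - (κ - w) = w by omega, Nat.cast_sub (by omega), ← mul_assoc, ← mul_assoc, ← pow_add,
      show κ - i + (κ - i - w) = 2 * (κ - i - w) + w by omega, pow_add, pow_mul]
    simp only [even_two, Even.neg_pow, one_pow, one_mul]
    congr 2
    ring

variable {R : Type*} [CommRing R] {V : ℕ → Type*} [∀ i, AddCommGroup (V i)]
  [∀ i, Module R (V i)]

/-- By `hΦ` every term is a multiple of some `Φ i κ (M i)`; collecting these leaves the scalar sums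
in `hw`. -/
theorem sum_alternating_family (Φ : ∀ i κ, V i →ₗ[R] V κ)
    (hΦ : ∀ i z κ, z ≤ κ → ∀ g, Φ z κ (Φ i z g) = ((κ - i).choose (κ - z) : R) • Φ i κ g)
    {m κ : ℕ} (w : ℕ → ℕ → ℤ) (F M : ∀ i, V i)
    (hF : ∀ z, F z = ∑ i ∈ Finset.range (m + 1), (w i z : R) • Φ i z (M i))
    (hw : ∀ i ≤ m, ∑ z ∈ Finset.range (κ + 1),
      ((-1) ^ (κ - z) * ((κ - i).choose (κ - z) : ℤ) * w i z) = 0) :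
    ∑ z ∈ Finset.range (κ + 1), ((-1) ^ (κ - z) : R) • Φ z κ (F z) = 0 := by
  have h1 : ∀ z ∈ Finset.range (κ + 1), ((-1) ^ (κ - z) : R) • Φ z κ (F z)
      = ∑ i ∈ Finset.range (m + 1),
        (((-1) ^ (κ - z) * ((κ - i).choose (κ - z) : ℤ) * w i z : ℤ) : R) • Φ i κ (M i) := by
    intro z hz
    rw [hF, map_sum, Finset.smul_sum]
    refine Finset.sum_congr rfl fun i _ => ?_
    rw [map_smul, hΦ i z κ (by simpa [Nat.lt_succ_iff] using hz), smul_smul, smul_smul]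
    congr 1
    push_cast
    ring
  rw [Finset.sum_congr rfl h1, Finset.sum_comm]
  refine Finset.sum_eq_zero fun i hi => ?_
  rw [← Finset.sum_smul, ← Int.cast_sum, hw i (by simpa [Nat.lt_succ_iff] using hi), Int.cast_zero,
    zero_smul]

/-- For `κ > m` the alternating sums of `S` and of `U` are both zero. Their terms with `z < κ` agree
by induction, so the terms `z = κ`, which are `S κ` and `U κ`, agree too. -/
theorem family_eq_of_le (Φ : ∀ i κ, V i →ₗ[R] V κ)
    (hΦ : ∀ i z κ, z ≤ κ → ∀ g, Φ z κ (Φ i z g) = ((κ - i).choose (κ - z) : R) • Φ i κ g)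
    (m : ℕ) (n : ℤ) (S U M T : ∀ i, V i)
    (hS : ∀ κ, S κ = ∑ i ∈ Finset.range (m + 1), Φ i κ (M i))
    (hU : ∀ κ, U κ = ∑ i ∈ Finset.range (m + 1),
      ((Ring.choose (n - κ) (m - i) : ℤ) : R) • Φ i κ (T i))
    (h : ∀ κ ≤ m, S κ = U κ) (κ : ℕ) : S κ = U κ := by
  induction κ using Nat.strong_induction_on with
  | _ κ ih =>
    by_cases hκ : κ ≤ m
    · exact h κ hκ
    have h1 := sum_alternating_family Φ hΦ (m := m) (κ := κ) (fun _ _ => 1) S M (by simpa using hS)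
      (fun i hi => by simpa using sum_alternating_choose κ i 0 0 (by omega))
    have h2 := sum_alternating_family Φ hΦ (κ := κ) (fun i z => Ring.choose (n - z) (m - i)) U T hU
      (fun i hi => sum_alternating_choose κ i (m - i) n (by omega))
    -- `Φ κ κ` is not assumed to be the identity, but it fixes the images of all `Φ i κ`, and these
    -- contain the summands of `S κ` and `U κ`.
    have hself : ∀ i (g : V i), Φ κ κ (Φ i κ g) = Φ i κ g := by
      intro i g
      rw [hΦ i κ κ le_rfl]
      simp
    have h3 : Φ κ κ (S κ) = S κ := by simp only [hS, map_sum, hself]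
    have h4 : Φ κ κ (U κ) = U κ := by simp only [hU, map_sum, map_smul, hself]
    rw [Finset.sum_range_succ, h3] at h1
    rw [Finset.sum_range_succ, h4, ← h1] at h2
    have h5 : ∑ z ∈ Finset.range κ, ((-1) ^ (κ - z) : R) • Φ z κ (S z)
        = ∑ z ∈ Finset.range κ, ((-1) ^ (κ - z) : R) • Φ z κ (U z) :=
      Finset.sum_congr rfl fun z hz => by rw [ih z (by simpa using hz)]
    rw [h5] at h2
    simpa using (add_left_cancel h2).symm

end families

/-! ### The strict tensor product on morphisms between words of labels. -/

theorem word_append (K L : List ℕ) : word (K ++ L) = word K ++ word L := by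
  induction K with
  | nil => rfl
  | cons k K ih => rw [List.cons_append, word_cons, word_cons, ih, List.append_assoc]

variable {R : Type u} [CommRing R] {N : ℕ} {P : ℕ → ℕ → ℕ → ℕ → Prop}

/-- Morphisms between the objects given by two lists of labels. -/
abbrev WHom (R : Type u) [CommRing R] (N : ℕ) (P : ℕ → ℕ → ℕ → ℕ → Prop) (K L : List ℕ) : Type u :=
  (⟨word K⟩ : Web R N P) ⟶ ⟨word L⟩

/-- The identity of a word. -/
abbrev idw (K : List ℕ) : WHom R N P K K := 𝟙 (⟨word K⟩ : Web R N P)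

/-- The tensor product of morphisms, with source and target given up to an equation of lists. -/
def tens {K L K' L' : List ℕ} (Z W : List ℕ) (f : WHom R N P K L) (g : WHom R N P K' L')
    (hZ : Z = K ++ K' := by rfl) (hW : W = L ++ L' := by rfl) : WHom R N P Z W :=
  Quotient.map₂ (fun f g => WebExpr.tensor f g (by rw [hZ, word_append]) (by rw [hW, word_append]))
    (fun _ _ h _ _ h' => Cong.tensor_congr _ _ h h') f g

section laws

variable {K L M K' L' M' K'' L'' Z V W U U' V' : List ℕ}

theorem tens_comp (f : WHom R N P K L) (g : WHom R N P L M) (f' : WHom R N P K' L')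
    (g' : WHom R N P L' M') (hZ : Z = K ++ K') (hW : W = M ++ M') (hV : V = L ++ L') :
    tens Z W (f ≫ g) (f' ≫ g') hZ hW = tens Z V f f' hZ hV ≫ tens V W g g' hV hW := by
  -- Stated for arbitrary objects, so that the equation for the middle object can be eliminated by
  -- substitution.
  have key : ∀ {A B C A' B' C' X Y T : Obj} (f : WebExpr R A B) (g : WebExpr R B C)
      (f' : WebExpr R A' B') (g' : WebExpr R B' C') (hX : X = A ++ A') (hY : Y = C ++ C')
      (hT : T = B ++ B'), Cong (DefRel R N P) (.tensor (.comp f g) (.comp f' g') hX hY)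
        (.comp (.tensor f f' hX hT) (.tensor g g' hT hY)) := by
    rintro A B C A' B' C' X Y T f g f' g' hX hY rfl
    exact Cong.tensor_comp f g f' g' hX hY
  induction f using Quotient.ind
  induction g using Quotient.ind
  induction f' using Quotient.ind
  induction g' using Quotient.ind
  exact Quotient.sound (key _ _ _ _ _ _ _)

theorem tens_id (hZ : Z = K ++ K') :
    tens Z Z (idw K) (idw K') hZ hZ = (idw Z : WHom R N P Z Z) :=
  Quotient.sound (Cong.tensor_id _ _)

theorem tens_assoc (f : WHom R N P K L) (g : WHom R N P K' L') (h : WHom R N P K'' L'')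
    (hU : U = K ++ K') (hV : V = L ++ L') (hU' : U' = K' ++ K'') (hV' : V' = L' ++ L'')
    (hZ : Z = U ++ K'') (hW : W = V ++ L'') (hZ' : Z = K ++ U') (hW' : W = L ++ V') :
    tens Z W (tens U V f g hU hV) h hZ hW = tens Z W f (tens U' V' g h hU' hV') hZ' hW' := by
  have key : ∀ {A B A' B' A'' B'' X Y X' Y' S T : Obj} (f : WebExpr R A B) (g : WebExpr R A' B')
      (h : WebExpr R A'' B'') (hX : X = A ++ A') (hY : Y = B ++ B') (hX' : X' = A' ++ A'')
      (hY' : Y' = B' ++ B'') (hS : S = X ++ A'') (hT : T = Y ++ B'') (hS' : S = A ++ X')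
      (hT' : T = B ++ Y'), Cong (DefRel R N P) (.tensor (.tensor f g hX hY) h hS hT)
        (.tensor f (.tensor g h hX' hY') hS' hT') := by
    rintro A B A' B' A'' B'' X Y X' Y' S T f g h rfl rfl rfl rfl hS hT hS' hT'
    exact Cong.tensor_assoc f g h hS' hT'
  induction f using Quotient.ind
  induction g using Quotient.ind
  induction h using Quotient.ind
  exact Quotient.sound (key _ _ _ _ _ _ _ _ _ _ _)

theorem unit_tens (f : WHom R N P K L) (hZ : K = [] ++ K) (hW : L = [] ++ L) :
    tens K L (idw []) f hZ hW = f := by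
  induction f using Quotient.ind
  exact Quotient.sound (Cong.unit_tensor _)

theorem tens_unit (f : WHom R N P K L) (hZ : K = K ++ []) (hW : L = L ++ []) :
    tens K L f (idw []) hZ hW = f := by
  induction f using Quotient.ind
  exact Quotient.sound (Cong.tensor_unit _)

theorem add_tens (f f' : WHom R N P K L) (g : WHom R N P K' L') (hZ : Z = K ++ K')
    (hW : W = L ++ L') :
    tens Z W (f + f') g hZ hW = tens Z W f g hZ hW + tens Z W f' g hZ hW := by
  induction f using Quotient.ind
  induction f' using Quotient.ind
  induction g using Quotient.ind
  exact Quotient.sound (Cong.add_tensor _ _ _ _ _)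

theorem tens_add (f : WHom R N P K L) (g g' : WHom R N P K' L') (hZ : Z = K ++ K')
    (hW : W = L ++ L') :
    tens Z W f (g + g') hZ hW = tens Z W f g hZ hW + tens Z W f g' hZ hW := by
  induction f using Quotient.ind
  induction g using Quotient.ind
  induction g' using Quotient.ind
  exact Quotient.sound (Cong.tensor_add _ _ _ _ _)

theorem smul_tens (r : R) (f : WHom R N P K L) (g : WHom R N P K' L') (hZ : Z = K ++ K')
    (hW : W = L ++ L') : tens Z W (r • f) g hZ hW = r • tens Z W f g hZ hW := by
  induction f using Quotient.ind
  induction g using Quotient.ind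
  exact Quotient.sound (Cong.smul_tensor _ _ _ _ _)

theorem tens_smul (r : R) (f : WHom R N P K L) (g : WHom R N P K' L') (hZ : Z = K ++ K')
    (hW : W = L ++ L') : tens Z W f (r • g) hZ hW = r • tens Z W f g hZ hW := by
  induction f using Quotient.ind
  induction g using Quotient.ind
  exact Quotient.sound (Cong.tensor_smul _ _ _ _ _)

theorem idw_tens_comp (f' : WHom R N P K' L') (g' : WHom R N P L' M') (hZ : Z = K ++ K')
    (hW : W = K ++ M') (hV : V = K ++ L') :
    tens Z W (idw K) (f' ≫ g') hZ hW
      = tens Z V (idw K) f' hZ hV ≫ tens V W (idw K) g' hV hW := by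
  rw [← tens_comp, Category.comp_id]

theorem comp_tens_idw (f : WHom R N P K L) (g : WHom R N P L M) (hZ : Z = K ++ K')
    (hW : W = M ++ K') (hV : V = L ++ K') :
    tens Z W (f ≫ g) (idw K') hZ hW
      = tens Z V f (idw K') hZ hV ≫ tens V W g (idw K') hV hW := by
  rw [← tens_comp, Category.comp_id]

theorem tens_eq_left_right (f : WHom R N P K L) (g : WHom R N P K' L') (hZ : Z = K ++ K')
    (hW : W = L ++ L') (hV : V = L ++ K') :
    tens Z W f g hZ hW = tens Z V f (idw K') hZ hV ≫ tens V W (idw L) g hV hW := by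
  rw [← tens_comp, Category.comp_id, Category.id_comp]

theorem tens_eq_right_left (f : WHom R N P K L) (g : WHom R N P K' L') (hZ : Z = K ++ K')
    (hW : W = L ++ L') (hV : V = K ++ L') :
    tens Z W f g hZ hW = tens Z V (idw K) g hZ hV ≫ tens V W f (idw L') hV hW := by
  rw [← tens_comp, Category.comp_id, Category.id_comp]

theorem interchange (f : WHom R N P K L) (g : WHom R N P K' L') (hZ : Z = K ++ K')
    (hW : W = L ++ L') (hV : V = K ++ L') (hU : U = L ++ K') :
    tens Z V (idw K) g hZ hV ≫ tens V W f (idw L') hV hW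
      = tens Z U f (idw K') hZ hU ≫ tens U W (idw L) g hU hW := by
  rw [← tens_eq_right_left, ← tens_eq_left_right]

theorem idw_tens_idw_tens (f : WHom R N P K L) (hU : U = K' ++ K) (hV : V = K' ++ L)
    (hZ : Z = K'' ++ U) (hW : W = K'' ++ V) (hM : M = K'' ++ K') (hZ' : Z = M ++ K)
    (hW' : W = M ++ L) :
    tens Z W (idw K'') (tens U V (idw K') f hU hV) hZ hW = tens Z W (idw M) f hZ' hW' := by
  rw [← tens_assoc _ _ _ hM hM hU hV hZ' hW' hZ hW, tens_id]

theorem tens_idw_tens_idw (f : WHom R N P K L) (hU : U = K ++ K') (hV : V = L ++ K')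
    (hZ : Z = U ++ K'') (hW : W = V ++ K'') (hM : M = K' ++ K'') (hZ' : Z = K ++ M)
    (hW' : W = L ++ M) :
    tens Z W (tens U V f (idw K') hU hV) (idw K'') hZ hW = tens Z W f (idw M) hZ' hW' := by
  rw [tens_assoc _ _ _ hU hV hM hM hZ hW hZ' hW', tens_id]

end laws

/-- `1_K ⊗ f` as a linear map. -/
def tensRightHom {K' L' : List ℕ} (Z W : List ℕ) {K L : List ℕ} (f : WHom R N P K L)
    (hZ : Z = K ++ K' := by rfl) (hW : W = L ++ L' := by rfl) :
    WHom R N P K' L' →ₗ[R] WHom R N P Z W where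
  toFun g := tens Z W f g hZ hW
  map_add' g g' := tens_add f g g' hZ hW
  map_smul' r g := tens_smul r f g hZ hW

/-- `f ↦ f ⊗ g` as a linear map. -/
def tensLeftHom {K L : List ℕ} (Z W : List ℕ) {K' L' : List ℕ} (g : WHom R N P K' L')
    (hZ : Z = K ++ K' := by rfl) (hW : W = L ++ L' := by rfl) :
    WHom R N P K L →ₗ[R] WHom R N P Z W where
  toFun f := tens Z W f g hZ hW
  map_add' f f' := add_tens f f' g hZ hW
  map_smul' r f := smul_tens r f g hZ hW

/-! ### Generators and relations -/

section generators

variable (R N P)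

/-- The merge `k ⊗ l → m`. -/
def mg (k l m : ℕ) (h : k + l = m) : WHom R N P [k, l] [m] := Web.ofExpr (.merge k l m h)

/-- The split `m → k ⊗ l`. -/
def sp (k l m : ℕ) (h : k + l = m) : WHom R N P [m] [k, l] := Web.ofExpr (.split k l m h)

/-- The crossing `k ⊗ l → l ⊗ k`. -/
def cr (k l : ℕ) : WHom R N P [k, l] [l, k] := Web.ofExpr (.cross k l)

/-- The cap on `k ⊗ k`. -/
def cp (k : ℕ) : WHom R N P [k, k] [] := Web.ofExpr (.cap k)

/-- The cup on `k ⊗ k`. -/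
def cu (k : ℕ) : WHom R N P [] [k, k] := Web.ofExpr (.cup k)

variable {R N P}

theorem ofExpr_comp {X Y Z : Obj} (f : WebExpr R X Y) (g : WebExpr R Y Z) :
    (Web.ofExpr (.comp f g) : (⟨X⟩ : Web R N P) ⟶ ⟨Z⟩) = Web.ofExpr f ≫ Web.ofExpr g := rfl

theorem ofExpr_sum {X Y : Obj} (n : ℕ) (t : ℕ → WebExpr R X Y) :
    (Web.ofExpr (WebExpr.sum (List.range n) t) : (⟨X⟩ : Web R N P) ⟶ ⟨Y⟩)
      = ∑ i ∈ Finset.range n, Web.ofExpr (t i) := by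
  have key : ∀ s : List ℕ, (Web.ofExpr (WebExpr.sum s t) : (⟨X⟩ : Web R N P) ⟶ ⟨Y⟩)
      = (s.map fun i => Web.ofExpr (t i)).sum := by
    intro s
    induction s with
    | nil => rfl
    | cons i s ih => rw [List.map_cons, List.sum_cons, ← ih]; rfl
  rw [key]
  rfl

theorem ofExpr_whisker {X Y Z W U V : List ℕ} (K : List ℕ) (f : WebExpr R (word X) (word Y))
    (L : List ℕ) (hU : U = X ++ L) (hV : V = Y ++ L) (hZ : Z = K ++ U) (hW : W = K ++ V)
    (hZ' : word Z = word K ++ (word X ++ word L)) (hW' : word W = word K ++ (word Y ++ word L)) :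
    (Web.ofExpr (WebExpr.whisker K f L hZ' hW') : WHom R N P Z W)
      = tens Z W (idw K) (tens U V (Web.ofExpr f) (idw L) hU hV) hZ hW := by
  have key : ∀ {A B A' B' A'' B'' X Y S T : Obj} (f : WebExpr R A B) (g : WebExpr R A' B')
      (h : WebExpr R A'' B'') (hX : X = A' ++ A'') (hY : Y = B' ++ B'') (hS : S = A ++ X)
      (hT : T = B ++ Y) (hS' : S = A ++ (A' ++ A'')) (hT' : T = B ++ (B' ++ B'')),
      (Web.ofExpr (.tensor f (.tensor g h rfl rfl) hS' hT') : (⟨S⟩ : Web R N P) ⟶ ⟨T⟩)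
        = Web.ofExpr (.tensor f (.tensor g h hX hY) hS hT) := by
    rintro A B A' B' A'' B'' X Y S T f g h rfl rfl hS hT hS' hT'
    rfl
  exact key _ _ _ _ _ _ _ _ _

theorem ofExpr_nil_whisker {X Y Z W : List ℕ} (f : WebExpr R (word X) (word Y))
    (L : List ℕ) (hZ : Z = X ++ L) (hW : W = Y ++ L)
    (hZ' : word Z = word [] ++ (word X ++ word L)) (hW' : word W = word [] ++ (word Y ++ word L)) :
    (Web.ofExpr (WebExpr.whisker [] f L hZ' hW') : WHom R N P Z W)
      = tens Z W (Web.ofExpr f) (idw L) hZ hW := by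
  exact (ofExpr_whisker [] f L hZ hW rfl rfl hZ' hW').trans (unit_tens _ _ _)

theorem ofExpr_whisker_nil {X Y Z W : List ℕ} (K : List ℕ) (f : WebExpr R (word X) (word Y))
    (hZ : Z = K ++ X) (hW : W = K ++ Y)
    (hZ' : word Z = word K ++ (word X ++ word [])) (hW' : word W = word K ++ (word Y ++ word [])) :
    (Web.ofExpr (WebExpr.whisker K f [] hZ' hW') : WHom R N P Z W)
      = tens Z W (idw K) (Web.ofExpr f) hZ hW := by
  rw [ofExpr_whisker K f [] (List.append_nil X).symm (List.append_nil Y).symm hZ hW, tens_unit]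

theorem ofExpr_eq {X Y : Obj} {f g : WebExpr R X Y} (h : DefRel R N P f g) :
    (Web.ofExpr f : (⟨X⟩ : Web R N P) ⟶ ⟨Y⟩) = Web.ofExpr g :=
  Quotient.sound (Cong.of h)

theorem mg_assoc {k l m s t n : ℕ} (hs : k + l = s) (ht : l + m = t) (hn : s + m = n)
    (hn' : k + t = n) :
    tens [k, l, m] [s, m] (mg R N P k l s hs) (idw [m]) ≫ mg R N P s m n hn
      = tens [k, l, m] [k, t] (idw [k]) (mg R N P l m t ht) ≫ mg R N P k t n hn' := by
  subst hs ht hn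
  have h := ofExpr_eq (R := R) (N := N) (P := P) (.assoc k l m)
  rw [ofExpr_comp, ofExpr_comp, ofExpr_nil_whisker _ _ rfl rfl, ofExpr_whisker_nil _ _ rfl rfl] at h
  exact h

theorem sp_coassoc {k l m s t n : ℕ} (hs : k + l = s) (ht : l + m = t) (hn : s + m = n)
    (hn' : k + t = n) :
    sp R N P s m n hn ≫ tens [s, m] [k, l, m] (sp R N P k l s hs) (idw [m])
      = sp R N P k t n hn' ≫ tens [k, t] [k, l, m] (idw [k]) (sp R N P l m t ht) := by
  subst hs ht hn
  have h := ofExpr_eq (R := R) (N := N) (P := P) (.coassoc k l m)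
  rw [ofExpr_comp, ofExpr_comp, ofExpr_nil_whisker _ _ rfl rfl, ofExpr_whisker_nil _ _ rfl rfl] at h
  exact h

theorem sp_mg {k l m : ℕ} (h : k + l = m) :
    sp R N P k l m h ≫ mg R N P k l m h = (m.choose k : R) • idw [m] := by
  subst h
  exact ofExpr_eq (.digon k l)

theorem zigzag_left (k : ℕ) :
    tens [k] [k, k, k] (cu R N P k) (idw [k]) ≫ tens [k, k, k] [k] (idw [k]) (cp R N P k)
      = idw [k] := by
  have h := ofExpr_eq (R := R) (N := N) (P := P) (.zigzag_left k)
  rw [ofExpr_comp, ofExpr_nil_whisker _ _ rfl rfl,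
    ofExpr_whisker_nil _ _ rfl rfl] at h
  exact h

theorem zigzag_right (k : ℕ) :
    tens [k] [k, k, k] (idw [k]) (cu R N P k) ≫ tens [k, k, k] [k] (cp R N P k) (idw [k])
      = idw [k] := by
  have h := ofExpr_eq (R := R) (N := N) (P := P) (.zigzag_right k)
  rw [ofExpr_comp, ofExpr_nil_whisker _ _ rfl rfl,
    ofExpr_whisker_nil _ _ rfl rfl] at h
  exact h

theorem rotate_mg {k l m : ℕ} (h : k + l = m) (h' : l + k = m) :
    tens [k, l, m] [m, m] (mg R N P k l m h) (idw [m]) ≫ cp R N P m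
      = tens [k, l, m] [k, l, l, k] (idw [k, l]) (sp R N P l k m h') ≫
        tens [k, l, l, k] [k, k] (idw [k]) (tens [l, l, k] [k] (cp R N P l) (idw [k])) ≫
          cp R N P k := by
  have h := ofExpr_eq (R := R) (N := N) (P := P) (.rotate_vertex_left k l m h)
  rw [ofExpr_comp, ofExpr_comp, ofExpr_comp,
    ofExpr_nil_whisker _ _ rfl rfl,
    ofExpr_whisker_nil _ _ rfl rfl,
    ofExpr_whisker (U := [l, l, k]) (V := [k]) _ _ _ rfl rfl rfl rfl] at h
  exact h

theorem rotate_sp {k l m : ℕ} (h : k + l = m) (h' : l + k = m) :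
    tens [m, k, l] [m, m] (idw [m]) (mg R N P k l m h) ≫ cp R N P m
      = tens [m, k, l] [l, k, k, l] (sp R N P l k m h') (idw [k, l]) ≫
        tens [l, k, k, l] [l, l] (idw [l]) (tens [k, k, l] [l] (cp R N P k) (idw [l])) ≫
          cp R N P l := by
  have h := ofExpr_eq (R := R) (N := N) (P := P) (.rotate_vertex_right k l m h)
  rw [ofExpr_comp, ofExpr_comp, ofExpr_comp,
    ofExpr_whisker_nil _ _ rfl rfl,
    ofExpr_nil_whisker _ _ rfl rfl,
    ofExpr_whisker (U := [k, k, l]) (V := [l]) _ _ _ rfl rfl rfl rfl] at h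
  exact h

end generators

/-! ### Acting next to a strand that is split off and merged back -/

/-- Split a strand labelled `c` off to the left, apply a morphism next to it, and merge the strand
back. -/
def bypass {A B : List ℕ} (c x y k p : ℕ) (hk : c + x = k) (hp : c + y = p) :
    WHom R N P (x :: A) (y :: B) →ₗ[R] WHom R N P (k :: A) (p :: B) where
  toFun g := tens (k :: A) (c :: x :: A) (sp R N P c x k hk) (idw A) ≫
    tens (c :: x :: A) (c :: y :: B) (idw [c]) g ≫
      tens (c :: y :: B) (p :: B) (mg R N P c y p hp) (idw B)
  map_add' g g' := by rw [tens_add, Preadditive.add_comp, Preadditive.comp_add]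
  map_smul' r g := by rw [tens_smul, Linear.smul_comp, Linear.comp_smul, RingHom.id_apply]

theorem bypass_apply {A B : List ℕ} (c x y k p : ℕ) (hk : c + x = k) (hp : c + y = p)
    (g : WHom R N P (x :: A) (y :: B)) :
    bypass c x y k p hk hp g = tens (k :: A) (c :: x :: A) (sp R N P c x k hk) (idw A) ≫
      tens (c :: x :: A) (c :: y :: B) (idw [c]) g ≫
        tens (c :: y :: B) (p :: B) (mg R N P c y p hp) (idw B) := rfl

/-- The shape of two nested bypasses: `a ≫ b` and `d ≫ e` are reassociated so that `b'` and `d'`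
close up around the middle `m`. -/
theorem comp_regroup {C : Type*} [Category C] {X₀ X₁ X₂ X₃ X₄ X₅ X₁' X₄' : C} {a : X₀ ⟶ X₁}
    {b : X₁ ⟶ X₂} {m : X₂ ⟶ X₃} {d : X₃ ⟶ X₄} {e : X₄ ⟶ X₅} {a' : X₀ ⟶ X₁'} {b' : X₁' ⟶ X₂}
    {d' : X₃ ⟶ X₄'} {e' : X₄' ⟶ X₅} {n : X₁' ⟶ X₄'} (hab : a ≫ b = a' ≫ b')
    (hde : d ≫ e = d' ≫ e') (hn : b' ≫ m ≫ d' = n) :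
    a ≫ (b ≫ m ≫ d) ≫ e = a' ≫ n ≫ e' := by
  rw [← hn]
  simp only [Category.assoc]
  rw [hde, reassoc_of% hab]

/-- Coassociativity and associativity gather the strands `c` and `c'` into one strand `e` containing
a digon; the digon is disjoint from `g` and contributes the binomial coefficient. -/
theorem bypass_bypass {A B : List ℕ} {c c' e x y z w k p : ℕ} (hk : c + z = k) (hp : c + w = p)
    (hz : c' + x = z) (hw : c' + y = w) (he : c + c' = e) (hk' : e + x = k) (hp' : e + y = p)
    (g : WHom R N P (x :: A) (y :: B)) :
    bypass c z w k p hk hp (bypass c' x y z w hz hw g)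
      = (e.choose c : R) • bypass e x y k p hk' hp' g := by
  rw [bypass_apply, bypass_apply, bypass_apply,
    idw_tens_comp (V := c :: c' :: x :: A) _ _ _ _ rfl,
    idw_tens_comp (V := c :: c' :: y :: B) _ _ _ _ rfl, ← Linear.comp_smul, ← Linear.smul_comp]
  refine comp_regroup
    (b' := tens (e :: x :: A) (c :: c' :: x :: A) (sp R N P c c' e he) (idw (x :: A)))
    (d' := tens (c :: c' :: y :: B) (e :: y :: B) (mg R N P c c' e he) (idw (y :: B))) ?_ ?_ ?_
  · rw [← tens_assoc (U := [c, z]) (V := [c, c', x]),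
      ← tens_idw_tens_idw (U := [e, x]) (V := [c, c', x]) (K' := [x]) (K'' := A)
        (f := sp R N P c c' e he),
      ← comp_tens_idw, ← comp_tens_idw, sp_coassoc (hn' := hk) (ht := hz)]
    all_goals rfl
  · rw [← tens_assoc (V := [c, w]) (U := [c, c', y]),
      ← tens_idw_tens_idw (V := [e, y]) (U := [c, c', y]) (K' := [y]) (K'' := B)
        (f := mg R N P c c' e he),
      ← comp_tens_idw, ← comp_tens_idw, mg_assoc (hn' := hp) (ht := hw)]
    all_goals rfl
  · rw [idw_tens_idw_tens (M := [c, c']), ← tens_comp,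
      ← tens_comp, Category.comp_id, Category.id_comp, Category.id_comp, sp_mg, smul_tens]
    all_goals rfl

/-- The two sides of a bypassed diagram may be modified away from the bypassing strand. -/
theorem split_tens_merge {A B A' B' : List ℕ} {c x y k p : ℕ} (hk : c + x = k) (hp : c + y = p)
    (σ : WHom R N P A A') (h : WHom R N P (x :: A') (y :: B')) (τ : WHom R N P B' B) :
    tens (k :: A) (c :: x :: A') (sp R N P c x k hk) σ ≫
      tens (c :: x :: A') (c :: y :: B') (idw [c]) h ≫
        tens (c :: y :: B') (p :: B) (mg R N P c y p hp) τ
      = bypass c x y k p hk hp (tens (x :: A) (x :: A') (idw [x]) σ ≫ h ≫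
          tens (y :: B') (y :: B) (idw [y]) τ) := by
  rw [bypass_apply, idw_tens_comp (V := c :: x :: A') _ _ _ _ rfl,
    idw_tens_comp (V := c :: y :: B') _ _ _ _ rfl,
    tens_eq_left_right (V := c :: x :: A) (hV := rfl) (f := sp R N P c x k hk),
    tens_eq_right_left (V := c :: y :: B) (hV := rfl) (f := mg R N P c y p hp),
    idw_tens_idw_tens (M := [c, x]), idw_tens_idw_tens (M := [c, y])]
  · simp only [Category.assoc]
  all_goals rfl

/-- Put a morphism between a cup-like morphism below and a cap-like morphism above, on strands to
its right. -/
def insertIn {A B A' B' : List ℕ} {a b : ℕ} (α : WHom R N P A (a :: A')) (ρ : WHom R N P A' B')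
    (β : WHom R N P (b :: B') B) (x y : ℕ) :
    WHom R N P [x, a] [y, b] →ₗ[R] WHom R N P (x :: A) (y :: B) where
  toFun g := tens (x :: A) (x :: a :: A') (idw [x]) α ≫
    tens (x :: a :: A') (y :: b :: B') g ρ ≫ tens (y :: b :: B') (y :: B) (idw [y]) β
  map_add' g g' := by rw [add_tens, Preadditive.add_comp, Preadditive.comp_add]
  map_smul' r g := by rw [smul_tens, Linear.smul_comp, Linear.comp_smul, RingHom.id_apply]

theorem insertIn_apply {A B A' B' : List ℕ} {a b : ℕ} (α : WHom R N P A (a :: A'))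
    (ρ : WHom R N P A' B') (β : WHom R N P (b :: B') B) (x y : ℕ) (g : WHom R N P [x, a] [y, b]) :
    insertIn α ρ β x y g = tens (x :: A) (x :: a :: A') (idw [x]) α ≫
      tens (x :: a :: A') (y :: b :: B') g ρ ≫
        tens (y :: b :: B') (y :: B) (idw [y]) β := rfl

/-- The bypassing strand lies to the left of everything that `α`, `ρ` and `β` touch, so its split
slides below `α` and its merge above `β`. -/
theorem insertIn_bypass {A B A' B' : List ℕ} {a b : ℕ} (α : WHom R N P A (a :: A'))
    (ρ : WHom R N P A' B') (β : WHom R N P (b :: B') B) {c x y k p : ℕ} (hk : c + x = k)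
    (hp : c + y = p) (g : WHom R N P [x, a] [y, b]) :
    insertIn α ρ β k p (bypass c x y k p hk hp g)
      = bypass c x y k p hk hp (insertIn α ρ β x y g) := by
  rw [insertIn_apply, insertIn_apply, ← split_tens_merge, bypass_apply]
  have h1 : tens (k :: a :: A') (p :: b :: B') (tens [k, a] [c, x, a] (sp R N P c x k hk) (idw [a]) ≫
        tens [c, x, a] [c, y, b] (idw [c]) g ≫ tens [c, y, b] [p, b] (mg R N P c y p hp) (idw [b])) ρ
      = tens (k :: a :: A') (c :: x :: a :: A') (sp R N P c x k hk) (idw (a :: A')) ≫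
        tens (c :: x :: a :: A') (c :: y :: b :: B') (idw [c])
          (tens (x :: a :: A') (y :: b :: B') g ρ) ≫
        tens (c :: y :: b :: B') (p :: b :: B') (mg R N P c y p hp) (idw (b :: B')) := by
    rw [← tens_idw_tens_idw (U := [k, a]) (V := [c, x, a]) (K' := [a]) (K'' := A')
        (Z := k :: a :: A') (f := sp R N P c x k hk),
      ← tens_idw_tens_idw (V := [p, b]) (U := [c, y, b]) (K' := [b]) (K'' := B')
        (W := p :: b :: B') (f := mg R N P c y p hp),
      ← tens_assoc (U := [c, x, a]) (V := [c, y, b]), ← tens_comp, ← tens_comp, Category.comp_id,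
      Category.id_comp]
    all_goals rfl
  rw [h1, tens_eq_left_right (V := c :: x :: A) (hV := rfl) (f := sp R N P c x k hk),
    tens_eq_right_left (V := c :: y :: B) (hV := rfl) (f := mg R N P c y p hp)]
  have h2 := interchange (sp R N P c x k hk) α (Z := k :: A) (V := k :: a :: A')
    (W := c :: x :: a :: A') (U := c :: x :: A) rfl rfl rfl rfl
  have h3 := interchange (mg R N P c y p hp) β (Z := c :: y :: b :: B') (V := c :: y :: B)
    (W := p :: B) (U := p :: b :: B') rfl rfl rfl rfl
  simp only [Category.assoc]
  rw [reassoc_of% h2, ← h3]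

/-! ### Ladders -/

theorem ofExpr_cupLadder {k l a k' l' : ℕ} (hk : k + a = k') (hl : a + l = l') :
    (Web.ofExpr (WebExpr.cupLadder k l a k' l' hk hl) : WHom R N P [k, l] [k', l'])
      = tens [k, l] [k, a, a, l] (idw [k]) (tens [l] [a, a, l] (cu R N P a) (idw [l])) ≫
        tens [k, a, a, l] [k', l'] (mg R N P k a k' hk) (mg R N P a l l' hl) :=
  congrArg (· ≫ tens [k, a, a, l] [k', l'] (mg R N P k a k' hk) (mg R N P a l l' hl))
    (ofExpr_whisker (Z := [k, l]) (W := [k, a, a, l]) (U := [l]) (V := [a, a, l]) [k] (.cup a) [l]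
      rfl rfl rfl rfl _ _)

theorem ofExpr_capLadder {k l a k' l' : ℕ} (hk : k' + a = k) (hl : a + l' = l) :
    (Web.ofExpr (WebExpr.capLadder k l a k' l' hk hl) : WHom R N P [k, l] [k', l'])
      = tens [k, l] [k', a, a, l'] (sp R N P k' a k hk) (sp R N P a l' l hl) ≫
        tens [k', a, a, l'] [k', l'] (idw [k'])
          (tens [a, a, l'] [l'] (cp R N P a) (idw [l'])) :=
  congrArg (tens [k, l] [k', a, a, l'] (sp R N P k' a k hk) (sp R N P a l' l hl) ≫ ·)
    (ofExpr_whisker (Z := [k', a, a, l']) (W := [k', l']) (U := [a, a, l']) (V := [l']) [k']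
      (.cap a) [l'] rfl rfl rfl rfl _ _)

/-- The crossing ladder without the strand that stays on the left. -/
def crossCore (a b e l s : ℕ) (hl : b + e = l) (hs : a + e = s) : WHom R N P [a, l] [b, s] :=
  tens [a, l] [a, b, e] (idw [a]) (sp R N P b e l hl) ≫
    tens [a, b, e] [b, a, e] (cr R N P a b) (idw [e]) ≫
      tens [b, a, e] [b, s] (idw [b]) (mg R N P a e s hs)

/-- The strand `c` that stays on the left is the bypass. The core does not involve `c`, so it is
unchanged when `k` and `r` grow together. -/
theorem ofExpr_crossLadder {k l r s a b c e : ℕ} (ha : a ≤ k) (hb : b ≤ l) (hr : k - a + b = r)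
    (hs : a + (l - b) = s) (hk : c + a = k) (hr' : c + b = r) (hl : b + e = l) (hs' : a + e = s) :
    (Web.ofExpr (WebExpr.crossLadder k l r s a b ha hb hr hs) : WHom R N P [k, l] [r, s])
      = bypass c a b k r hk hr' (crossCore a b e l s hl hs') := by
  obtain rfl : c = k - a := by omega
  obtain rfl : e = l - b := by omega
  rw [crossCore, ← split_tens_merge]
  exact congrArg (fun t => tens [k, l] [k - a, a, b, l - b] (sp R N P (k - a) a k hk)
      (sp R N P b (l - b) l hl) ≫ t ≫ tens [k - a, b, a, l - b] [r, s] (mg R N P (k - a) b r hr')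
      (mg R N P a (l - b) s hs'))
    (ofExpr_whisker (Z := [k - a, a, b, l - b]) (W := [k - a, b, a, l - b]) (U := [a, b, l - b])
      (V := [b, a, l - b]) [k - a] (.cross a b) [l - b] rfl rfl rfl rfl _ _)

theorem mg_sp {k l r s m : ℕ} (hkl : k + l = m) (hrs : r + s = m) :
    mg R N P k l m hkl ≫ sp R N P r s m hrs
      = ∑ a ∈ Finset.range (k + 1), ∑ b ∈ Finset.range (l + 1),
        if h : a ≤ k ∧ b ≤ l ∧ k - a + b = r then
          ((-1) ^ (a * b) : R) • (Web.ofExpr (WebExpr.crossLadder k l r s a b h.1 h.2.1 h.2.2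
            (by omega)) : WHom R N P [k, l] [r, s])
        else 0 := by
  refine (ofExpr_eq (.schur k l r s m hkl hrs)).trans ?_
  rw [ofExpr_sum]
  refine Finset.sum_congr rfl fun a _ => ?_
  rw [ofExpr_sum]
  refine Finset.sum_congr rfl fun b _ => ?_
  split_ifs <;> rfl

/-- A cap ladder followed by a cup ladder, without the strand that stays on the left. -/
def capCupCore (j j' e l q : ℕ) (hl : j + e = l) (hq : j' + e = q) : WHom R N P [j, l] [j', q] :=
  tens [j, l] [j, j, e] (idw [j]) (sp R N P j e l hl) ≫
    (tens [j, j, e] [e] (cp R N P j) (idw [e]) ≫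
      tens [e] [j', j', e] (cu R N P j') (idw [e])) ≫
        tens [j', j', e] [j', q] (idw [j']) (mg R N P j' e q hq)

/-- The cap ladder splits the strand `c` off, the cup ladder merges it back, and nothing touches it
in between. -/
theorem capLadder_comp_cupLadder {k l j c e j' p q : ℕ} (hk : c + j = k) (hl : j + e = l)
    (hp : c + j' = p) (hq : j' + e = q) :
    (Web.ofExpr (WebExpr.capLadder k l j c e hk hl) : WHom R N P [k, l] [c, e]) ≫
      (Web.ofExpr (WebExpr.cupLadder c e j' p q hp hq) : WHom R N P [c, e] [p, q])
      = bypass c j j' k p hk hp (capCupCore j j' e l q hl hq) := by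
  rw [ofExpr_capLadder, ofExpr_cupLadder, capCupCore, ← split_tens_merge,
    idw_tens_comp (V := [c, e]) (hV := rfl)]
  simp only [Category.assoc]

theorem ofExpr_efLeft {k l a b p q s t : ℕ} (hp : p + b = k + a) (hq : q + b = l + a)
    (hs : k + a = s) (hs' : p + b = s) (ht : a + l = t) (ht' : b + q = t) :
    (Web.ofExpr (WebExpr.efLeft k l a b p q hp hq) : WHom R N P [k, l] [p, q])
      = Web.ofExpr (WebExpr.cupLadder k l a s t hs ht) ≫
        Web.ofExpr (WebExpr.capLadder s t b p q hs' ht') := by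
  subst hs
  obtain rfl : t = l + a := by omega
  rfl

/-- Isolates the merge followed by the split on the left strand, where the Schur relation is to be
applied. -/
theorem ofExpr_efLeft_eq_insertIn {k l a b p q s t : ℕ} (hp : p + b = k + a) (hq : q + b = l + a)
    (hs : k + a = s) (hs' : p + b = s) (ht : a + l = t) (ht' : b + q = t) :
    (Web.ofExpr (WebExpr.efLeft k l a b p q hp hq) : WHom R N P [k, l] [p, q])
      = insertIn (A := [l]) (A' := [a, l]) (B := [q]) (B' := [b, q])
          (tens [l] [a, a, l] (cu R N P a) (idw [l])) (mg R N P a l t ht ≫ sp R N P b q t ht')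
          (tens [b, b, q] [q] (cp R N P b) (idw [q])) k p
          (mg R N P k a s hs ≫ sp R N P p b s hs') := by
  rw [ofExpr_efLeft hp hq hs hs' ht ht', ofExpr_cupLadder, ofExpr_capLadder, insertIn_apply,
    tens_comp (V := [s, t]) (hV := rfl)]
  simp only [Category.assoc]

/-! ### Families indexed by the thickness of the left strand -/

/-- The bypass in terms of the thickness above fixed offsets `d`, `d'`; zero if the strand to be
split off would have negative thickness. -/
def bypassFrom {A B : List ℕ} (d d' i κ : ℕ) :
    WHom R N P ((d + i) :: A) ((d' + i) :: B) →ₗ[R] WHom R N P ((d + κ) :: A) ((d' + κ) :: B) :=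
  if h : i ≤ κ then bypass (κ - i) (d + i) (d' + i) (d + κ) (d' + κ) (by omega) (by omega) else 0

/-- The convention for negative thickness respects the composition rule: for `i > z` the left side
is zero, and on the right either the binomial coefficient or `bypassFrom` is zero. -/
theorem bypassFrom_bypassFrom {A B : List ℕ} {d d' i z κ : ℕ} (hz : z ≤ κ)
    (g : WHom R N P ((d + i) :: A) ((d' + i) :: B)) :
    bypassFrom d d' z κ (bypassFrom d d' i z g)
      = ((κ - i).choose (κ - z) : R) • bypassFrom d d' i κ g := by
  by_cases hi : i ≤ z
  · rw [bypassFrom, bypassFrom, bypassFrom, dif_pos hz, dif_pos hi, dif_pos (hi.trans hz),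
      bypass_bypass (he := show κ - z + (z - i) = κ - i by omega)]
  · rw [bypassFrom, bypassFrom, dif_neg hi, LinearMap.zero_apply, map_zero]
    by_cases hi' : i ≤ κ
    · rw [Nat.choose_eq_zero_of_lt (by omega), Nat.cast_zero, zero_smul]
    · rw [bypassFrom, dif_neg hi', LinearMap.zero_apply, smul_zero]

/-- A Schur term crossing `x` to the right and `y` to the left has `x - y = d - d'`. As one offset
is zero, `x = d + i` and `y = d' + i` with `i ≥ 0`. The right strand forces `i ≤ m` whatever `κ` is,
and neither the core nor the sign involves `κ`. -/
theorem mg_sp_eq_sum_bypassFrom {d d' m κ s : ℕ} (hd : d = 0 ∨ d' = 0)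
    (hs : d + κ + (d' + m) = s) (hs' : d' + κ + (d + m) = s) :
    mg R N P (d + κ) (d' + m) s hs ≫ sp R N P (d' + κ) (d + m) s hs'
      = ∑ i ∈ Finset.range (m + 1), bypassFrom (A := [d' + m]) (B := [d + m]) d d' i κ
          (if h : i ≤ m then ((-1) ^ ((d + i) * (d' + i)) : R) •
            crossCore (d + i) (d' + i) (m - i) (d' + m) (d + m) (by omega) (by omega) else 0) := by
  rw [mg_sp, ← Finset.sum_product']
  symm
  have hi : ∀ i ∈ Finset.range (m + 1), bypassFrom (A := [d' + m]) (B := [d + m]) d d' i κ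
          (if h : i ≤ m then ((-1) ^ ((d + i) * (d' + i)) : R) •
            crossCore (d + i) (d' + i) (m - i) (d' + m) (d + m) (by omega) (by omega) else 0) ≠
            (0 : WHom R N P [d + κ, d' + m] [d' + κ, d + m]) → i ≤ m ∧ i ≤ κ := by
    intro i hi h
    refine ⟨by simpa [Nat.lt_succ_iff] using hi, ?_⟩
    by_contra h'
    exact h (by rw [bypassFrom, dif_neg h', LinearMap.zero_apply])
  -- The index sets correspond only away from zero terms: `i > κ` on one side, pairs with the wrong
  -- difference on the other.
  refine Finset.sum_bij_ne_zero (fun i _ _ => (d + i, d' + i)) ?_ ?_ ?_ ?_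
  · intro i h1 h2
    have := hi i h1 h2
    simp only [Finset.mem_product, Finset.mem_range]
    omega
  · intro i _ _ j _ _ h
    simpa using h
  · rintro ⟨x, y⟩ hxy hne
    have h : x ≤ d + κ ∧ y ≤ d' + m ∧ d + κ - x + y = d' + κ := by
      by_contra h
      exact hne (dif_neg h)
    obtain ⟨i, rfl, rfl⟩ : ∃ i, x = d + i ∧ y = d' + i := by
      rcases hd with rfl | rfl
      · exact ⟨x, by omega, by omega⟩
      · exact ⟨y, by omega, by omega⟩
    refine ⟨i, by simp only [Finset.mem_range]; omega, ?_, rfl⟩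
    rw [dif_pos h, ofExpr_crossLadder (c := κ - i) (e := m - i) (hk := by omega)
      (hr' := by omega) (hl := by omega) (hs' := by omega)] at hne
    rw [bypassFrom, dif_pos (by omega), dif_pos (by omega), map_smul]
    exact hne
  · intro i h1 h2
    obtain ⟨him, hiκ⟩ := hi i h1 h2
    rw [bypassFrom, dif_pos hiκ, dif_pos him, map_smul, dif_pos (by omega),
      ofExpr_crossLadder (c := κ - i) (e := m - i) (hk := by omega)
      (hr' := by omega) (hl := by omega) (hs' := by omega)]

/-! ### Rotation -/

section mates

variable {X X' Y Y' U U' V V' Q Q' S T Z W : List ℕ}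

/-- The pairing of `X ⊗ U` with `U' ⊗ X'` obtained from pairings of `X` with `X'` and of `U`
with `U'`. -/
def nest (Z X X' : List ℕ) (ε : WHom R N P S []) (δ : WHom R N P Q []) (hS : S = X ++ X' := by rfl)
    (hZ : Z = X ++ (Q ++ X') := by rfl) : WHom R N P Z [] :=
  tens Z S (idw X) (tens (Q ++ X') X' δ (idw X')) hZ hS ≫ ε

/-- Two morphisms are mates if sliding one of them along the pairings yields the other. -/
def Mate (ε : WHom R N P S []) (δ : WHom R N P T []) (f : WHom R N P X Y) (g : WHom R N P Y' X')
    (hS : S = X ++ X' := by rfl) (hT : T = Y ++ Y' := by rfl) : Prop :=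
  tens (X ++ Y') T f (idw Y') rfl hT ≫ δ = tens (X ++ Y') S (idw X) g rfl hS ≫ ε

/-- `f'` slides through the pairings first and `f` second, which reverses the order on the other
side. -/
theorem Mate.comp {ε : WHom R N P S []} {δ : WHom R N P T []} {ζ : WHom R N P Q []}
    {f : WHom R N P X Y} {g : WHom R N P Y' X'} {f' : WHom R N P Y Z} {g' : WHom R N P W Y'}
    {hS : S = X ++ X'} {hT : T = Y ++ Y'} {hQ : Q = Z ++ W} (h : Mate ε δ f g hS hT)
    (h' : Mate δ ζ f' g' hT hQ) : Mate ε ζ (f ≫ f') (g' ≫ g) hS hQ := by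
  unfold Mate at *
  rw [comp_tens_idw (V := Y ++ W) _ _ _ _ rfl, idw_tens_comp (V := X ++ Y') _ _ _ _ rfl,
    Category.assoc, Category.assoc, ← h, h', ← Category.assoc, ← Category.assoc, interchange]

/-- The slide takes place inside the outer pairing `ζ`, which is left alone. -/
theorem Mate.left {ε : WHom R N P S []} {δ : WHom R N P T []} {ζ : WHom R N P Q []}
    {f : WHom R N P U V} {g : WHom R N P V' U'} {hS : S = U ++ U'} {hT : T = V ++ V'}
    {hQ : Q = X ++ X'} (h : Mate ε δ f g hS hT) {A B C D E F : List ℕ} (hA : A = X ++ U)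
    (hB : B = X ++ V) (hC : C = V' ++ X') (hD : D = U' ++ X') (hE : E = X ++ (S ++ X'))
    (hF : F = X ++ (T ++ X')) (hE' : E = A ++ D) (hF' : F = B ++ C) :
    Mate (nest E X X' ζ ε hQ hE) (nest F X X' ζ δ hQ hF) (tens A B (idw X) f hA hB)
      (tens C D g (idw X') hC hD) hE' hF' := by
  unfold Mate nest at *
  subst hA hB hC hD
  have e1 : tens (X ++ U ++ (V' ++ X')) F (tens (X ++ U) (X ++ V) (idw X) f rfl rfl)
      (idw (V' ++ X')) rfl hF'
      = tens (X ++ U ++ (V' ++ X')) F (idw X) (tens (U ++ V' ++ X') (T ++ X')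
        (tens (U ++ V') T f (idw V') rfl hT) (idw X')) (by simp) hF := by
    rw [tens_idw_tens_idw (M := V' ++ X'), ← tens_assoc (U := X ++ U) (V := X ++ V)]
    all_goals first | rfl | simp [hT]
  have e2 : tens (X ++ U ++ (V' ++ X')) E (idw (X ++ U))
      (tens (V' ++ X') (U' ++ X') g (idw X') rfl rfl) rfl hE'
      = tens (X ++ U ++ (V' ++ X')) E (idw X) (tens (U ++ V' ++ X') (S ++ X')
        (tens (U ++ V') S (idw U) g rfl hS) (idw X')) (by simp) hE := by
    rw [tens_assoc (U' := V' ++ X') (V' := U' ++ X'), idw_tens_idw_tens (M := X ++ U)]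
    all_goals first | rfl | simp [hS]
  rw [e1, e2, ← Category.assoc, ← Category.assoc, ← idw_tens_comp, ← idw_tens_comp,
    ← comp_tens_idw, ← comp_tens_idw, h]

/-- Here `ζ` is the inner pairing: `f` and `g` are disjoint from it and move past it (`e3`, `e4`).
-/
theorem Mate.right {ε : WHom R N P S []} {δ : WHom R N P T []} {ζ : WHom R N P Q []}
    {f : WHom R N P X Y} {g : WHom R N P Y' X'} {hS : S = X ++ X'} {hT : T = Y ++ Y'}
    (hQ : Q = U ++ U') (h : Mate ε δ f g hS hT) {A B C D E F : List ℕ} (hA : A = X ++ U)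
    (hB : B = Y ++ U) (hC : C = U' ++ Y') (hD : D = U' ++ X') (hE : E = X ++ (Q ++ X'))
    (hF : F = Y ++ (Q ++ Y')) (hE' : E = A ++ D) (hF' : F = B ++ C) :
    Mate (nest E X X' ε ζ hS hE) (nest F Y Y' δ ζ hT hF) (tens A B f (idw U) hA hB)
      (tens C D (idw U') g hC hD) hE' hF' := by
  unfold Mate nest at *
  subst hA hB hC hD
  have hZ : X ++ U ++ (U' ++ Y') = X ++ (Q ++ Y') := by simp [hQ]
  have e1 : tens (X ++ U ++ (U' ++ Y')) F (tens (X ++ U) (Y ++ U) f (idw U) rfl rfl)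
      (idw (U' ++ Y')) rfl hF'
      = tens (X ++ U ++ (U' ++ Y')) F f (idw (Q ++ Y')) hZ hF := by
    rw [tens_idw_tens_idw]
    all_goals simp [hQ]
  have e2 : tens (X ++ U ++ (U' ++ Y')) E (idw (X ++ U))
      (tens (U' ++ Y') (U' ++ X') (idw U') g rfl rfl) rfl hE'
      = tens (X ++ U ++ (U' ++ Y')) E (idw X) (tens (Q ++ Y') (Q ++ X') (idw Q) g) hZ hE := by
    rw [idw_tens_idw_tens (M := X ++ Q), idw_tens_idw_tens (M := X ++ Q)]
    all_goals first | rfl | simp [hQ, hE]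
  have e3 := interchange (Z := X ++ U ++ (U' ++ Y')) (V := X ++ Y') (U := F) (W := T) f
    (tens (Q ++ Y') Y' ζ (idw Y')) hZ hT rfl hF
  have e4 := interchange (Z := Q ++ Y') (V := Q ++ X') (U := Y') (W := X') ζ g rfl rfl rfl rfl
  rw [unit_tens] at e4
  rw [e1, e2, ← reassoc_of% e3, h, ← Category.assoc, ← Category.assoc, ← idw_tens_comp,
    ← idw_tens_comp, e4]

theorem Mate.tens {ε : WHom R N P S []} {δ : WHom R N P T []} {ε' : WHom R N P Q []}
    {δ' : WHom R N P Q' []} {f : WHom R N P X Y} {g : WHom R N P Y' X'} {f' : WHom R N P U V}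
    {g' : WHom R N P V' U'} {hS : S = X ++ X'} {hT : T = Y ++ Y'} {hQ : Q = U ++ U'}
    {hQ' : Q' = V ++ V'} (h : Mate ε δ f g hS hT) (h' : Mate ε' δ' f' g' hQ hQ')
    {A B C D E F : List ℕ} (hA : A = X ++ U) (hB : B = Y ++ V) (hC : C = V' ++ Y')
    (hD : D = U' ++ X') (hE : E = X ++ (Q ++ X')) (hF : F = Y ++ (Q' ++ Y')) (hE' : E = A ++ D)
    (hF' : F = B ++ C) :
    Mate (nest E X X' ε ε' hS hE) (nest F Y Y' δ δ' hT hF) (OrthWeb.tens A B f f' hA hB)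
      (OrthWeb.tens C D g' g hC hD) hE' hF' := by
  rw [tens_eq_left_right (V := Y ++ U) (hV := rfl) f f',
    tens_eq_left_right (V := U' ++ Y') (hV := rfl) g' g]
  exact (h.right (F := Y ++ (Q ++ Y')) hQ hA rfl rfl hD hE rfl hE' (by simp [hQ])).comp
    (h'.left rfl hB hC rfl rfl hF (by simp [hQ]) hF')

theorem Mate.sum {ι : Type*} (s : Finset ι) (c : ι → R) {ε : WHom R N P S []} {δ : WHom R N P T []}
    {f : ι → WHom R N P X Y} {g : ι → WHom R N P Y' X'} {hS : S = X ++ X'} {hT : T = Y ++ Y'}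
    (h : ∀ i ∈ s, Mate ε δ (f i) (g i) hS hT) :
    Mate ε δ (∑ i ∈ s, c i • f i) (∑ i ∈ s, c i • g i) hS hT := by
  have e1 := map_sum (tensLeftHom (R := R) (X ++ Y') T (idw Y') rfl hT) (fun i => c i • f i) s
  have e2 := map_sum (tensRightHom (R := R) (X ++ Y') S (idw X) rfl hS) (fun i => c i • g i) s
  simp only [map_smul] at e1 e2
  refine (congrArg (· ≫ δ) e1).trans (Eq.trans ?_ (congrArg (· ≫ ε) e2).symm)
  simp only [Preadditive.sum_comp, Linear.smul_comp]
  exact Finset.sum_congr rfl fun i hi => congrArg (c i • ·) (h i hi)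

theorem mate_zero {ε : WHom R N P S []} {δ : WHom R N P T []} {hS : S = X ++ X'}
    {hT : T = Y ++ Y'} :
    Mate ε δ (0 : WHom R N P X Y) (0 : WHom R N P Y' X') hS hT := by
  simpa using Mate.sum (ε := ε) (δ := δ) (f := fun _ => 0) (g := fun _ => 0) (hS := hS) (hT := hT)
    (∅ : Finset ℕ) (fun _ => 0) (by simp)

/-- A morphism is determined by its mate if the pairing on the target has a copairing. -/
theorem Mate.unique {ε : WHom R N P S []} {δ : WHom R N P T []} {f f' : WHom R N P X Y}
    {g : WHom R N P Y' X'} {hS : S = X ++ X'} {hT : T = Y ++ Y'} (h : Mate ε δ f g hS hT)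
    (h' : Mate ε δ f' g hS hT) (η : WHom R N P [] W) (hW : W = Y' ++ Y)
    (hY : Y = Y ++ []) (hη : OrthWeb.tens Y (Y ++ W) (idw Y) η hY rfl ≫
      OrthWeb.tens (Y ++ W) Y δ (idw Y) (by simp [hT, hW]) rfl = idw Y) : f = f' := by
  -- Bending the target round with `η` and `δ` recovers `f` from its composite with `δ`, and the
  -- mate prescribes that composite.
  have key : ∀ f : WHom R N P X Y, f = OrthWeb.tens X (X ++ W) (idw X) η (by simp) rfl ≫
      OrthWeb.tens (X ++ W) Y (OrthWeb.tens (X ++ Y') T f (idw Y') rfl hT ≫ δ) (idw Y)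
        (by simp [hW]) rfl := by
    intro f
    have e1 := interchange (Z := X) (V := X ++ W) (U := Y) (W := Y ++ W) f η
      (by simp) rfl rfl hY
    rw [tens_unit] at e1
    rw [comp_tens_idw (V := Y ++ W), tens_idw_tens_idw (M := W), reassoc_of% e1, hη,
      Category.comp_id]
    all_goals first | rfl | simp [hW, hT]
  rw [key f, key f']
  unfold Mate at h h'
  rw [h, h']

end mates

/-! ### Nested caps and the mates of trivalent vertices and ladders. -/

theorem nest_assoc {X X' U U' S Q T Z V W : List ℕ} (ε : WHom R N P S []) (δ : WHom R N P Q [])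
    (ζ : WHom R N P T []) (hS : S = X ++ X') (hQ : Q = U ++ U') (hV : V = X ++ (Q ++ X'))
    {A A' : List ℕ} (hA : A = X ++ U) (hA' : A' = U' ++ X') (hVA : V = A ++ A')
    (hZ : Z = A ++ (T ++ A')) (hW : W = U ++ (T ++ U')) (hZ' : Z = X ++ (W ++ X')) :
    nest Z A A' (nest V X X' ε δ hS hV) ζ hVA hZ
      = nest Z X X' ε (nest W U U' δ ζ hQ hW) hS hZ' := by
  subst hA hA'
  unfold nest
  have e : tens Z V (idw (X ++ U)) (tens (T ++ (U' ++ X')) (U' ++ X') ζ (idw (U' ++ X'))) hZ hVA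
      = tens Z V (idw X) (tens (W ++ X') (Q ++ X')
          (tens W Q (idw U) (tens (T ++ U') U' ζ (idw U')) hW hQ) (idw X')) hZ' hV := by
    rw [tens_assoc (U' := T ++ (U' ++ X')) (V' := U' ++ X'), idw_tens_idw_tens (M := X ++ U),
      tens_idw_tens_idw (M := U' ++ X')]
    all_goals first | rfl | simp [hW, hQ]
  rw [e, comp_tens_idw (V := Q ++ X'), idw_tens_comp (V := V), Category.assoc]

theorem unit_nest {k l : ℕ} (ε : WHom R N P [k, l] []) :
    nest [k, l] [] [] (idw []) ε = ε := by
  unfold nest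
  rw [Category.comp_id]
  exact (unit_tens _ _ _).trans (tens_unit _ _ _)

variable (R N P) in
/-- Two nested caps. -/
def nestCap (k l : ℕ) : WHom R N P [k, l, l, k] [] :=
  nest [k, l, l, k] [k] [k] (cp R N P k) (cp R N P l)

theorem nestCap_eq (k l : ℕ) :
    nestCap R N P k l = tens [k, l, l, k] [k, k] (idw [k])
      (tens [l, l, k] [k] (cp R N P l) (idw [k])) ≫ cp R N P k := rfl

theorem mate_mg {k l m : ℕ} (h : k + l = m) (h' : l + k = m) :
    Mate (nestCap R N P k l) (cp R N P m) (mg R N P k l m h) (sp R N P l k m h') :=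
  rotate_mg h h'

theorem mate_sp {k l m : ℕ} (h : k + l = m) (h' : l + k = m) :
    Mate (cp R N P m) (nestCap R N P k l) (sp R N P k l m h) (mg R N P l k m h') :=
  (rotate_sp h' h).symm

theorem mate_cu (k : ℕ) :
    Mate (X := []) (X' := []) (idw []) (nestCap R N P k k) (cu R N P k) (cp R N P k) := by
  have e1 : tens [k, k] [k, k, k, k] (cu R N P k) (idw [k, k])
      = tens [k, k] [k, k, k, k] (tens [k] [k, k, k] (cu R N P k) (idw [k])) (idw [k]) := by
    rw [tens_idw_tens_idw]
    rfl
  have e2 : tens [k, k, k, k] [k, k] (idw [k]) (tens [k, k, k] [k] (cp R N P k) (idw [k]))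
      = tens [k, k, k, k] [k, k] (tens [k, k, k] [k] (idw [k]) (cp R N P k)) (idw [k]) := by
    rw [tens_assoc]
  have e3 : tens [k, k] [] (idw []) (cp R N P k) = cp R N P k := unit_tens _ _ _
  change tens [k, k] [k, k, k, k] (cu R N P k) (idw [k, k]) ≫
    tens [k, k, k, k] [k, k] (idw [k]) (tens [k, k, k] [k] (cp R N P k) (idw [k])) ≫ cp R N P k
      = tens [k, k] [] (idw []) (cp R N P k) ≫ idw []
  rw [e1, e2, e3, ← Category.assoc, ← comp_tens_idw, zigzag_left, tens_id, Category.id_comp,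
    Category.comp_id]

theorem mate_cp (k : ℕ) :
    Mate (Y := []) (Y' := []) (nestCap R N P k k) (idw []) (cp R N P k) (cu R N P k) := by
  have e1 : tens [k, k] [k, k, k, k] (idw [k, k]) (cu R N P k)
      = tens [k, k] [k, k, k, k] (idw [k]) (tens [k] [k, k, k] (idw [k]) (cu R N P k)) := by
    rw [idw_tens_idw_tens]
    rfl
  have e3 : tens [k, k] [] (cp R N P k) (idw []) = cp R N P k := tens_unit _ _ _
  change tens [k, k] [] (cp R N P k) (idw []) ≫ idw [] =
    tens [k, k] [k, k, k, k] (idw [k, k]) (cu R N P k) ≫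
    tens [k, k, k, k] [k, k] (idw [k]) (tens [k, k, k] [k] (cp R N P k) (idw [k])) ≫ cp R N P k
  rw [e1, e3, ← Category.assoc, ← idw_tens_comp, zigzag_right, tens_id, Category.id_comp,
    Category.comp_id]

/-- The pairing on `k ⊗ a ⊗ a ⊗ l`. -/
theorem nest_nestCap (k a l : ℕ) :
    nest [k, a, a, l, l, a, a, k] [k, a] [a, k] (nestCap R N P k a) (nestCap R N P a l)
      = nest [k, a, a, l, l, a, a, k] [k] [k] (cp R N P k)
          (nest [a, a, l, l, a, a] [a, a] [a, a] (nestCap R N P a a) (cp R N P l)) := by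
  have e1 := nest_assoc (cp R N P k) (cp R N P a) (nestCap R N P a l) (X := [k]) (X' := [k])
    (U := [a]) (U' := [a]) (V := [k, a, a, k]) (A := [k, a]) (A' := [a, k])
    (Z := [k, a, a, l, l, a, a, k]) (W := [a, a, l, l, a, a]) rfl rfl rfl rfl rfl rfl rfl rfl rfl
  have e2 := nest_assoc (cp R N P a) (cp R N P a) (cp R N P l) (X := [a]) (X' := [a])
    (U := [a]) (U' := [a]) (V := [a, a, a, a]) (A := [a, a]) (A' := [a, a])
    (Z := [a, a, l, l, a, a]) (W := [a, l, l, a]) rfl rfl rfl rfl rfl rfl rfl rfl rfl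
  exact e1.trans (congrArg (nest [k, a, a, l, l, a, a, k] [k] [k] (cp R N P k) · rfl rfl) e2.symm)

/-- A half turn makes the cup a cap and the merges splits, and exchanges the two strands. -/
theorem mate_cupLadder {k l a k' l' : ℕ} (hk : k + a = k') (hl : a + l = l') (hl' : l + a = l')
    (hk' : a + k = k') :
    Mate (nestCap R N P k l) (nestCap R N P k' l')
      (Web.ofExpr (WebExpr.cupLadder k l a k' l' hk hl) : WHom R N P [k, l] [k', l'])
      (Web.ofExpr (WebExpr.capLadder l' k' a l k hl' hk') : WHom R N P [l', k'] [l, k]) := by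
  rw [ofExpr_cupLadder, ofExpr_capLadder]
  refine Mate.comp (hT := rfl) (δ := nest [k, a, a, l, l, a, a, k] [k, a] [a, k] (nestCap R N P k a)
    (nestCap R N P a l)) ?_ ?_
  · have h1 := (mate_cu (R := R) (N := N) (P := P) a).right (ζ := cp R N P l) (U := [l])
      (U' := [l]) (A := [l]) (B := [a, a, l]) (C := [l, a, a]) (D := [l]) (E := [l, l])
      (F := [a, a, l, l, a, a]) rfl rfl rfl rfl rfl rfl rfl rfl rfl
    have h2 := h1.left (ζ := cp R N P k) (X := [k]) (X' := [k]) (A := [k, l])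
      (B := [k, a, a, l]) (C := [l, a, a, k]) (D := [l, k]) (E := [k, l, l, k])
      (F := [k, a, a, l, l, a, a, k]) (hQ := rfl) rfl rfl rfl rfl rfl rfl rfl rfl
    rw [unit_nest] at h2
    -- The cup groups the four strands as `k (a a) l`, the merges as `(k a) (a l)`; the two nested
    -- pairings agree.
    rw [nest_nestCap]
    have e : tens [l, a, a, k] [l, k] (tens [l, a, a] [l] (idw [l]) (cp R N P a)) (idw [k])
        = tens [l, a, a, k] [l, k] (idw [l]) (tens [a, a, k] [k] (cp R N P a) (idw [k])) := by
      rw [tens_assoc]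
    rw [← e]
    exact h2
  · exact (mate_mg hk hk').tens (mate_mg hl hl') rfl rfl rfl rfl rfl rfl rfl rfl

theorem mate_capLadder {k l a k' l' : ℕ} (hk : k' + a = k) (hl : a + l' = l) (hl' : l' + a = l)
    (hk' : a + k' = k) :
    Mate (nestCap R N P k l) (nestCap R N P k' l')
      (Web.ofExpr (WebExpr.capLadder k l a k' l' hk hl) : WHom R N P [k, l] [k', l'])
      (Web.ofExpr (WebExpr.cupLadder l' k' a l k hl' hk') : WHom R N P [l', k'] [l, k]) := by
  rw [ofExpr_cupLadder, ofExpr_capLadder]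
  refine Mate.comp (hT := rfl) (δ := nest [k', a, a, l', l', a, a, k'] [k', a] [a, k'] (nestCap R N P k' a)
    (nestCap R N P a l')) ?_ ?_
  · exact (mate_sp hk hk').tens (mate_sp hl hl') rfl rfl rfl rfl rfl rfl rfl rfl
  · have h1 := (mate_cp (R := R) (N := N) (P := P) a).right (ζ := cp R N P l') (U := [l'])
      (U' := [l']) (B := [l']) (A := [a, a, l']) (D := [l', a, a]) (C := [l']) (F := [l', l'])
      (E := [a, a, l', l', a, a]) rfl rfl rfl rfl rfl rfl rfl rfl rfl
    have h2 := h1.left (ζ := cp R N P k') (X := [k']) (X' := [k']) (B := [k', l'])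
      (A := [k', a, a, l']) (D := [l', a, a, k']) (C := [l', k']) (F := [k', l', l', k'])
      (E := [k', a, a, l', l', a, a, k']) (hQ := rfl) rfl rfl rfl rfl rfl rfl rfl rfl
    rw [unit_nest] at h2
    rw [nest_nestCap]
    have e : tens [l', k'] [l', a, a, k'] (tens [l'] [l', a, a] (idw [l']) (cu R N P a)) (idw [k'])
        = tens [l', k'] [l', a, a, k'] (idw [l']) (tens [k'] [a, a, k'] (cu R N P a) (idw [k'])) := by
      rw [tens_assoc]
    rw [← e]
    exact h2

variable (R N P) in
/-- Two nested cups. -/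
def nestCup (p q : ℕ) : WHom R N P [] [q, p, p, q] :=
  cu R N P q ≫ tens [q, q] [q, p, p, q] (idw [q]) (tens [q] [p, p, q] (cu R N P p) (idw [q]))

theorem zigzag_nest (p q : ℕ) :
    tens [p, q] [p, q, q, p, p, q] (idw [p, q]) (nestCup R N P p q) ≫
      tens [p, q, q, p, p, q] [p, q] (nestCap R N P p q) (idw [p, q]) = idw [p, q] := by
  rw [nestCup, nestCap_eq, idw_tens_comp (V := [p, q, q, q]) (hV := rfl), comp_tens_idw (V := [p, p, p, q]) (hV := rfl)]
  have e1 : tens [p, q] [p, q, q, q] (idw [p, q]) (cu R N P q)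
      = tens [p, q] [p, q, q, q] (idw [p]) (tens [q] [q, q, q] (idw [q]) (cu R N P q)) := by
    rw [idw_tens_idw_tens]
    rfl
  have e2 : tens [p, p, p, q] [p, q] (cp R N P p) (idw [p, q])
      = tens [p, p, p, q] [p, q] (tens [p, p, p] [p] (cp R N P p) (idw [p])) (idw [q]) := by
    rw [tens_idw_tens_idw]
    rfl
  have e3 : tens [p, q, q, q] [p, q, q, p, p, q] (idw [p, q])
        (tens [q, q] [q, p, p, q] (idw [q]) (tens [q] [p, p, q] (cu R N P p) (idw [q])))
      = tens [p, q, q, q] [p, q, q, p, p, q] (idw [p]) (tens [q, q, q] [q, q, p, p, q] (idw [q, q])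
        (tens [q] [p, p, q] (cu R N P p) (idw [q]))) := by
    rw [idw_tens_idw_tens (M := [p, q, q]),
      idw_tens_idw_tens (M := [p, q, q])] <;> rfl
  have e4 : tens [p, q, q, p, p, q] [p, p, p, q]
        (tens [p, q, q, p] [p, p] (idw [p]) (tens [q, q, p] [p] (cp R N P q) (idw [p])))
        (idw [p, q])
      = tens [p, q, q, p, p, q] [p, p, p, q] (idw [p]) (tens [q, q, p, p, q] [p, p, q]
        (cp R N P q) (idw [p, p, q])) := by
    rw [tens_assoc (U' := [q, q, p, p, q]) (V' := [p, p, q]) , tens_idw_tens_idw (M := [p, p, q])] <;> rfl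
  -- Moving the cap on `q` below the cup on `p` separates the diagram into two single zigzags.
  have e5 := interchange (Z := [q, q, q]) (V := [q, q, p, p, q]) (U := [q]) (W := [p, p, q])
    (cp R N P q) (tens [q] [p, p, q] (cu R N P p) (idw [q])) rfl rfl rfl rfl
  have e6 : tens [q] [p, p, q] (idw []) (tens [q] [p, p, q] (cu R N P p) (idw [q]))
    = tens [q] [p, p, q] (cu R N P p) (idw [q]) := unit_tens _ _ _
  have e7 : tens [p, q] [p, p, p, q] (idw [p]) (tens [q] [p, p, q] (cu R N P p) (idw [q]))
      = tens [p, q] [p, p, p, q] (tens [p] [p, p, p] (idw [p]) (cu R N P p)) (idw [q]) := by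
    rw [tens_assoc]
  rw [e1, e2, e3, e4, Category.assoc]
  rw [← Category.assoc (tens [p, q, q, q] [p, q, q, p, p, q] _ _ _ _), ← idw_tens_comp, e5, e6,
    idw_tens_comp (V := [p, q]) (hV := rfl), Category.assoc, e7, ← comp_tens_idw, zigzag_right,
    ← Category.assoc, ← idw_tens_comp, zigzag_right, tens_id, Category.comp_id]

/-! ### The `E`-`F` relations in terms of thickness -/

variable (R N P) in
/-- The diagram with a cap ladder of thickness `d + i` followed by a cup ladder of thickness
`d' + i`. -/
def capCup (d d' κ μ i : ℕ) : WHom R N P [d + κ, d + μ] [d' + κ, d' + μ] :=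
  if h : i ≤ κ ∧ i ≤ μ then
    (Web.ofExpr (WebExpr.capLadder (d + κ) (d + μ) (d + i) (κ - i) (μ - i) (by omega) (by omega)) :
      WHom R N P [d + κ, d + μ] [κ - i, μ - i]) ≫
    (Web.ofExpr (WebExpr.cupLadder (κ - i) (μ - i) (d' + i) (d' + κ) (d' + μ) (by omega)
      (by omega)) : WHom R N P [κ - i, μ - i] [d' + κ, d' + μ])
  else 0

variable (R N P) in
/-- The higher even orthogonal `E`-`F` relation with `k = d + κ`, `l = d + μ`, `a = d' + m` and
`b = d + m`. -/
def EFRel (d d' m κ μ : ℕ) : Prop :=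
  (Web.ofExpr (WebExpr.efLeft (d + κ) (d + μ) (d' + m) (d + m) (d' + κ) (d' + μ) (by omega)
      (by omega)) : WHom R N P [d + κ, d + μ] [d' + κ, d' + μ])
    = ∑ i ∈ Finset.range (m + 1),
      ((Ring.choose ((N : ℤ) - d - d' - μ - κ) (m - i) : ℤ) : R) • capCup R N P d d' κ μ i

theorem ofExpr_efRight {k l a b p q x j c e j' : ℕ} (hp : p + b = k + a) (hq : q + b = l + a)
    (hx : x ≤ a ∧ x ≤ b ∧ b ≤ k + x ∧ b ≤ l + x) (hj : j + x = b) (hj' : j' + x = a)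
    (hk : c + j = k) (hl : j + e = l) (hp' : c + j' = p) (hq' : j' + e = q) :
    (Web.ofExpr (WebExpr.efRight k l a b p q hp hq x) : WHom R N P [k, l] [p, q])
      = (Web.ofExpr (WebExpr.capLadder k l j c e hk hl) : WHom R N P [k, l] [c, e]) ≫
        (Web.ofExpr (WebExpr.cupLadder c e j' p q hp' hq') : WHom R N P [c, e] [p, q]) := by
  obtain rfl : j = b - x := by omega
  obtain rfl : j' = a - x := by omega
  obtain rfl : c = k - (b - x) := by omega
  obtain rfl : e = l - (b - x) := by omega
  rw [WebExpr.efRight, dif_pos hx]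
  rfl

/-- With `x = m - i` the ladders have thicknesses `d + i` and `d' + i`, free of `m`, and the upper
entry `N - k - l + b - a` becomes `N - d - d' - μ - κ`, which is invariant under a half turn. -/
theorem ef_iff_efRel {k l a b p q d d' m κ μ : ℕ} (hp : p + b = k + a) (hq : q + b = l + a)
    (hd : d = 0 ∨ d' = 0) (hk : k = d + κ) (hl : l = d + μ) (ha : a = d' + m) (hb : b = d + m) :
    (Web.ofExpr (WebExpr.efLeft k l a b p q hp hq) : WHom R N P [k, l] [p, q])
        = ∑ x ∈ Finset.range (min a b + 1), (efCoeff N k l a b x : R) •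
          (Web.ofExpr (WebExpr.efRight k l a b p q hp hq x) : WHom R N P [k, l] [p, q])
      ↔ EFRel R N P d d' m κ μ := by
  subst hk hl ha hb
  obtain rfl : p = d' + κ := by omega
  obtain rfl : q = d' + μ := by omega
  unfold EFRel
  rw [show min (d' + m) (d + m) = m by omega, ← Finset.sum_flip]
  refine Eq.congr_right (Finset.sum_congr rfl fun i hi => ?_)
  have hi' : i ≤ m := by simpa [Nat.lt_succ_iff] using hi
  have hc : efCoeff N (d + κ) (d + μ) (d' + m) (d + m) (m - i)
      = Ring.choose ((N : ℤ) - d - d' - μ - κ) (m - i) := by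
    unfold efCoeff
    congr 1
    rcases hd with rfl | rfl <;> push_cast <;> ring
  rw [hc]
  congr 1
  unfold capCup
  -- At `x = m - i` the condition in `efRight` that no label is negative amounts to this one.
  by_cases h : i ≤ κ ∧ i ≤ μ
  · rw [dif_pos h, ofExpr_efRight (hx := by omega) (j := d + i) (j' := d' + i) (c := κ - i)
      (e := μ - i) (hj := by omega) (hj' := by omega) (hk := by omega) (hl := by omega)
      (hp' := by omega) (hq' := by omega)]
  · rw [dif_neg h, WebExpr.efRight, dif_neg (by omega)]
    rfl

/-- The `E`-`F` relations are invariant under rotation. -/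
theorem EFRel.rotate {d d' m κ μ : ℕ} (h : EFRel R N P d d' m κ μ) : EFRel R N P d' d m μ κ := by
  unfold EFRel at h ⊢
  have h1 : Mate (nestCap R N P (d' + μ) (d' + κ)) (nestCap R N P (d + μ) (d + κ))
      (Web.ofExpr (WebExpr.efLeft (d' + μ) (d' + κ) (d + m) (d' + m) (d + μ) (d + κ) (by omega)
        (by omega)) : WHom R N P [d' + μ, d' + κ] [d + μ, d + κ])
      (Web.ofExpr (WebExpr.efLeft (d + κ) (d + μ) (d' + m) (d + m) (d' + κ) (d' + μ) (by omega)
        (by omega)) : WHom R N P [d + κ, d + μ] [d' + κ, d' + μ]) := by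
    rw [ofExpr_efLeft (s := d + d' + m + μ) (t := d + d' + m + κ) (hs := by omega)
        (hs' := by omega) (ht := by omega) (ht' := by omega),
      ofExpr_efLeft (s := d + d' + m + κ) (t := d + d' + m + μ) (hs := by omega)
        (hs' := by omega) (ht := by omega) (ht' := by omega)]
    exact (mate_cupLadder _ _ _ _).comp (hT := rfl) (mate_capLadder _ _ _ _)
  have h2 : ∀ i ∈ Finset.range (m + 1),
      Mate (nestCap R N P (d' + μ) (d' + κ)) (nestCap R N P (d + μ) (d + κ))
        (capCup R N P d' d μ κ i) (capCup R N P d d' κ μ i) := by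
    intro i _
    unfold capCup
    by_cases hi : i ≤ κ ∧ i ≤ μ
    · rw [dif_pos hi, dif_pos hi.symm]
      exact (mate_capLadder _ _ _ _).comp (hT := rfl) (mate_cupLadder _ _ _ _)
    · rw [dif_neg hi, dif_neg (mt And.symm hi)]
      exact mate_zero
  have h3 := Mate.sum _ (fun i => ((Ring.choose ((N : ℤ) - d - d' - μ - κ) (m - i) : ℤ) : R)) h2
  rw [← h] at h3
  have h4 := h1.unique h3 (nestCup R N P (d + μ) (d + κ)) rfl rfl (zigzag_nest _ _)
  -- The coefficients survive the rotation because their upper entry is symmetric in the exchanged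
  -- parameters.
  rw [h4, show (N : ℤ) - d - d' - μ - κ = N - d' - d - κ - μ by ring]

/-- The `E`-`F` relations for thin left strands imply those for arbitrary left strands. -/
theorem EFRel.of_thin_left {d d' m μ : ℕ} (hd : d = 0 ∨ d' = 0)
    (h : ∀ κ ≤ m, EFRel R N P d d' m κ μ) (κ : ℕ) : EFRel R N P d d' m κ μ := by
  refine family_eq_of_le (R := R) (V := fun κ => WHom R N P [d + κ, d + μ] [d' + κ, d' + μ])
    (bypassFrom d d') (fun i z κ hz g => bypassFrom_bypassFrom hz g) m ((N : ℤ) - d - d' - μ)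
    (fun κ => Web.ofExpr (WebExpr.efLeft (d + κ) (d + μ) (d' + m) (d + m) (d' + κ) (d' + μ)
      (by omega) (by omega)))
    (fun κ => ∑ i ∈ Finset.range (m + 1),
      ((Ring.choose ((N : ℤ) - d - d' - μ - κ) (m - i) : ℤ) : R) • capCup R N P d d' κ μ i)
    (fun i => insertIn (A := [d + μ]) (A' := [d' + m, d + μ]) (B := [d' + μ])
      (B' := [d + m, d' + μ])
      (tens [d + μ] [d' + m, d' + m, d + μ] (cu R N P (d' + m)) (idw [d + μ]))
      (mg R N P (d' + m) (d + μ) (d + d' + m + μ) (by omega) ≫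
        sp R N P (d + m) (d' + μ) (d + d' + m + μ) (by omega))
      (tens [d + m, d + m, d' + μ] [d' + μ] (cp R N P (d + m)) (idw [d' + μ])) (d + i) (d' + i)
      (if h : i ≤ m then ((-1) ^ ((d + i) * (d' + i)) : R) •
        crossCore (d + i) (d' + i) (m - i) (d' + m) (d + m) (by omega) (by omega) else 0))
    (fun i => if h : i ≤ μ then
      capCupCore (d + i) (d' + i) (μ - i) (d + μ) (d' + μ) (by omega) (by omega) else 0)
    ?_ ?_ h κ
  -- The Schur relation on the left strand, carried through the surrounding cup, cap and right
  -- strand.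
  · intro κ
    rw [ofExpr_efLeft_eq_insertIn (s := d + d' + m + κ) (t := d + d' + m + μ) (hs := by omega)
      (hs' := by omega) (ht := by omega) (ht' := by omega), mg_sp_eq_sum_bypassFrom hd, map_sum]
    refine Finset.sum_congr rfl fun i _ => ?_
    unfold bypassFrom
    by_cases hi : i ≤ κ
    · rw [dif_pos hi, dif_pos hi, insertIn_bypass]
    · rw [dif_neg hi, dif_neg hi, LinearMap.zero_apply, map_zero, LinearMap.zero_apply]
  -- A term with `i > κ` is killed by `bypassFrom`, one with `i > μ` by the choice of the core as
  -- zero.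
  · intro κ
    refine Finset.sum_congr rfl fun i _ => ?_
    congr 1
    unfold capCup bypassFrom
    by_cases hi : i ≤ κ
    · by_cases hi' : i ≤ μ
      · rw [dif_pos ⟨hi, hi'⟩, dif_pos hi, dif_pos hi', capLadder_comp_cupLadder]
      · rw [dif_neg (fun h => hi' h.2), dif_neg hi', map_zero]
    · rw [dif_neg (fun h => hi h.1), dif_neg hi, LinearMap.zero_apply]

/-! ### From small parameters to all parameters. -/

/-- The left strand is made thin first. The right strand is then treated as the left strand of the
rotated relation, in which the offsets have traded places, whence `.inr`. For `d = 0`, thinness of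
both strands is `Small`. -/
theorem efRel_of_small {d d' m κ μ : ℕ} (hd : d = 0) :
    EFRel R N Small d d' m κ μ := by
  refine EFRel.of_thin_left (.inl hd) (fun κ hκ => ?_) κ
  refine EFRel.rotate (EFRel.of_thin_left (.inr hd) (fun μ hμ => EFRel.rotate ?_) μ)
  refine (ef_iff_efRel (by omega) (by omega) (.inl hd) rfl rfl rfl rfl).1
    ((ofExpr_eq (.ef (d + κ) (d + μ) (d' + m) (d + m) (d' + κ) (d' + μ) (by omega) (by omega)
      ⟨by omega, by omega⟩)).trans (ofExpr_sum _ _))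

end OrthWeb


open OrthWeb in
theorem lemmaL {R : Type u} [CommRing R] (N k l a b p q : ℕ)
    (hp : p + b = k + a) (hq : q + b = l + a) :
    (Web.ofExpr (WebExpr.efLeft k l a b p q hp hq) :
        (⟨word [k, l]⟩ : Web R N Small) ⟶ ⟨word [p, q]⟩) =
      ∑ x ∈ Finset.range (min a b + 1),
        (efCoeff N k l a b x : R) • Web.ofExpr (WebExpr.efRight k l a b p q hp hq x) := by
  rcases le_total b a with h | h
  · exact (ef_iff_efRel (d := 0) (d' := a - b) (m := b) (κ := k) (μ := l) hp hq (.inl rfl)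
      (by omega) (by omega) (by omega) (by omega)).2 (efRel_of_small rfl)
  -- For `a ≤ b` the relation with offsets `(b - a, 0)` is a half turn of the one with offsets `(0,
  -- b - a)`; the levels are `p` and `q` because `k = (b - a) + p` and `l = (b - a) + q`.
  · exact (ef_iff_efRel (d := b - a) (d' := 0) (m := a) (κ := p) (μ := q) hp hq (.inr rfl)
      (by omega) (by omega) (by omega) (by omega)).2 (efRel_of_small rfl).rotate
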